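/- Let $M$ be a smooth ($C^\infty$, Hausdorff, finite-dimensional) manifold, let $\Omega_M$ be its algebra of differential forms, and let $\mathbb{T}M=TM\oplus T^*M$ be the generalized tangent bundle with the tautological inner product $\langle X+\xi,Y+\eta\rangle=\tfrac12(\xi(Y)+\eta(X))$ and the Dorfman bracket $[\![X+\xi,Y+\eta]\!]=[X,Y]+\mathcal L_X\eta-\iota_Y d\xi$. Sections of $\mathbb{T}M$ act on $\Omega_M$ as odd operators by $(X+\xi)\alpha=\iota_X\alpha+\xi\wedge\alpha$, and $[\cdot,\cdot]$ denotes the graded commutator of $\mathbb R$-linear operators on $\Omega_M$. A *generalized polynomial structure* of degree $N\ge 1$ with minimal polynomial $P$ is a smooth bundle endomorphism $\varphi$ of $\mathbb{T}M$, skew-symmetric with respect to $\langle\cdot,\cdot\rangle$, together with a monic polynomial $P\in\mathbb R[x]$ of degree $N$ that is the minimal polynomial of $\varphi_p:\mathbb{T}_pM\to\mathbb{T}_pM$ for every $p\in M$. Every skew-symmetric endomorphism $\varphi$ has a unique lift $\widetilde\varphi$, i.e. an even $\mathbb R$-linear operator on $\Omega_M$ which commutes with multiplication by functions, satisfies $[\widetilde\varphi,\mathbf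 x]=\varphi(\mathbf x)$ for all sections $\mathbf x$ of $\mathbb{T}M$, and satisfies $\widetilde\varphi(1)\in\Omega^2_M$. The structure $\varphi$ is called *minimal* if its minimal torsion vanishes, that is, if for the operator $\delta_\varphi=P(\mathrm{ad}_{\widetilde\varphi})(d)$, with $d$ the de Rham differential, $$\mathcal M_\varphi(\mathbf x,\mathbf y)=[[\mathbf x,\delta_\varphi],\mathbf y]=0\quad\text{for all sections }\mathbf x,\mathbf y\text{ of }\mathbb{T}M.$$ For sections $\mathbf x,\mathbf y$ of $\mathbb{T}M$ put $$\mathcal T_\varphi(\mathbf x,\mathbf y)=\varphi^2[\![\mathbf x,\mathbf y]\!]+[\![\varphi\mathbf x,\varphi\mathbf y]\!]-\varphi\big([\![\varphi\mathbf x,\mathbf y]\!]+[\![\mathbf x,\varphi\mathbf y]\!]\big),\qquad \mathcal S_\varphi(\mathbf x,\mathbf y)=\mathcal T_\varphi(\varphi\mathbf x,\mathbf y)+\mathcal T_\varphi(\mathbf x,\varphi\mathbf y).$$ Call $\varphi$ a *generalized Nijenhuis operator* if $\mathcal T_\varphi=0$, and a *weak generalized Nijenhuis operator* if $\mathcal S_\varphi=0$.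 Let $\varphi$ be a generalized polynomial structure on $M$. 1. If $\varphi$ is a generalized Nijenhuis operator, then $\varphi$ is minimal. 2. If $\varphi$ has odd degree and is a weak generalized Nijenhuis operator, then $\varphi$ is minimal. -/

import Mathlib

open scoped Manifold ContDiff

set_option linter.unusedSectionVars false

noncomputable section

namespace GenGeom

/-! ### Vector fields and differential forms on a smooth manifold of dimension `n` -/

/-- The model space `ℝⁿ`. -/
abbrev Model (n : ℕ) : Type := EuclideanSpace ℝ (Fin n)

variable {n : ℕ} {M : Type*} [TopologicalSpace M] [ChartedSpace (Model n) M]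
  [IsManifold (𝓡 n) ∞ M]

variable (n) in
/-- The tangent space `T_p M`. -/
abbrev Tan (p : M) : Type := TangentSpace (𝓡 n) p

variable (n M) in
/-- Smooth vector fields on `M`. -/
abbrev VF : Type _ := ContMDiffSection (𝓡 n) (Model n) ∞ (TangentSpace (𝓡 n) : M → Type _)

variable (n M) in
/-- Smooth differential `k`-forms: a family of alternating `k`-linear forms on the tangent spaces
which gives a smooth function when evaluated on smooth vector fields. -/
structure Form (k : ℕ) : Type _ where
  toFun : ∀ p : M, (Tan n p) [⋀^Fin k]→ₗ[ℝ] ℝ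
  smooth' : ∀ X : Fin k → VF n M,
    ContMDiff (𝓡 n) 𝓘(ℝ, ℝ) ∞ (fun p => toFun p (fun i => X i p))

namespace Form
variable {k : ℕ}

instance : CoeFun (Form n M k) (fun _ => ∀ p : M, (Tan n p) [⋀^Fin k]→ₗ[ℝ] ℝ) := ⟨toFun⟩

theorem ext {α β : Form n M k} (h : ∀ p, α p = β p) : α = β := by
  cases α; cases β; congr; funext p; exact h p

instance : Zero (Form n M k) := ⟨⟨fun _ => 0, fun _ => contMDiff_const⟩⟩
instance : Add (Form n M k) :=
  ⟨fun α β => ⟨fun p => α p + β p, fun X => (α.smooth' X).add (β.smooth' X)⟩⟩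
instance : Neg (Form n M k) := ⟨fun α => ⟨fun p => -α p, fun X => (α.smooth' X).neg⟩⟩
instance : SMul ℝ (Form n M k) :=
  ⟨fun c α => ⟨fun p => c • α p, fun X =>
    (contMDiff_const (c := c)).mul (α.smooth' X)⟩⟩

@[simp] theorem zero_apply (p : M) : (0 : Form n M k) p = 0 := rfl
@[simp] theorem add_apply (α β : Form n M k) (p : M) : (α + β) p = α p + β p := rfl
@[simp] theorem neg_apply (α : Form n M k) (p : M) : (-α) p = -α p := rfl
@[simp] theorem smul_apply (c : ℝ) (α : Form n M k) (p : M) : (c • α) p = c • α p := rfl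

instance : AddCommGroup (Form n M k) where
  add_assoc _ _ _ := ext fun _ => add_assoc _ _ _
  zero_add _ := ext fun _ => zero_add _
  add_zero _ := ext fun _ => add_zero _
  add_comm _ _ := ext fun _ => add_comm _ _
  neg_add_cancel _ := ext fun _ => neg_add_cancel _
  nsmul := nsmulRec
  zsmul := zsmulRec

instance : Module ℝ (Form n M k) where
  one_smul _ := ext fun _ => one_smul _ _
  mul_smul _ _ _ := ext fun _ => mul_smul _ _ _
  smul_zero _ := ext fun _ => smul_zero _
  smul_add _ _ _ := ext fun _ => smul_add _ _ _
  add_smul _ _ _ := ext fun _ => add_smul _ _ _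
  zero_smul _ := ext fun _ => zero_smul _ _

/-- Multiplication of a form by a smooth function. -/
def mulFun (f : C^∞⟮𝓡 n, M; 𝓘(ℝ, ℝ), ℝ⟯) : Form n M k →ₗ[ℝ] Form n M k where
  toFun α := ⟨fun p => f p • α p, fun X => f.contMDiff.mul (α.smooth' X)⟩
  map_add' _ _ := ext fun _ => smul_add _ _ _
  map_smul' _ _ := ext fun _ => smul_comm _ _ _

/-- The constant function `1`, as a `0`-form. -/
def one : Form n M 0 := ⟨fun _ => AlternatingMap.constOfIsEmpty ℝ _ (Fin 0) 1,
  fun _ => contMDiff_const⟩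

/-- Contraction `ι_X` (insertion of `X` in the first slot). -/
def contract (X : VF n M) : Form n M (k + 1) →ₗ[ℝ] Form n M k where
  toFun α := ⟨fun p => (α p).curryLeft (X p), fun Y => by
    have h := α.smooth' (Fin.cons X Y)
    refine h.congr fun p => ?_
    rw [AlternatingMap.curryLeft_apply_apply]
    congr 1
    funext i
    refine Fin.cases ?_ (fun j => ?_) i <;> rfl⟩
  map_add' _ _ := ext fun _ => rfl
  map_smul' _ _ := ext fun _ => rfl

/-- Left exterior multiplication by a `1`-form:
`(ξ ∧ α)(v₀, …, v_k) = ∑ᵢ (-1)ⁱ ξ(vᵢ) α(v₀, …, v̂ᵢ, …, v_k)`. -/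
def wedge (ξ : Form n M 1) : Form n M k →ₗ[ℝ] Form n M (k + 1) where
  toFun α := ⟨fun p => AlternatingMap.alternatizeUncurryFin
      (LinearMap.smulRight ((AlternatingMap.ofSubsingleton ℝ _ ℝ (0 : Fin 1)).symm (ξ p)) (α p)),
    fun Y => by
      simp only [AlternatingMap.alternatizeUncurryFin_apply]
      refine contMDiff_finsetSum fun i _ => ?_
      refine ((contMDiff_const (c := ((-1) ^ (i : ℕ) : ℝ))).mul
        ((ξ.smooth' fun _ => Y i).mul (α.smooth' (i.removeNth Y)))).congr fun p => ?_
      rw [zsmul_eq_mul]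
      push_cast
      rfl⟩
  map_add' α β := ext fun p => by
    ext v
    simp [AlternatingMap.alternatizeUncurryFin_apply, Finset.sum_add_distrib, smul_add]
  map_smul' c α := ext fun p => by
    ext v
    simp [AlternatingMap.alternatizeUncurryFin_apply, Finset.mul_sum, mul_left_comm]
end Form

theorem continuous_alternating {k : ℕ} (f : (Model n) [⋀^Fin k]→ₗ[ℝ] ℝ) : Continuous f := by
  have h : ∀ v : Fin k → Model n, f v = ∑ r : Fin k → Fin n,
      (∏ i, (v i) (r i)) • f (fun i => (EuclideanSpace.basisFun (Fin n) ℝ) (r i)) := by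
    intro v
    have hv : v = fun i => ∑ j, (v i) j • (EuclideanSpace.basisFun (Fin n) ℝ) j := by
      funext i
      simpa using ((EuclideanSpace.basisFun (Fin n) ℝ).sum_repr (v i)).symm
    conv_lhs => rw [hv]
    change f.toMultilinearMap _ = _
    rw [MultilinearMap.map_sum]
    refine Finset.sum_congr rfl fun r _ => ?_
    rw [MultilinearMap.map_smul_univ]
    rfl
  rw [show (f : (Fin k → Model n) → ℝ) = _ from funext h]
  fun_prop

/-- On `ℝⁿ` every alternating form is continuous. -/
def toCont {k : ℕ} (f : (Model n) [⋀^Fin k]→ₗ[ℝ] ℝ) : (Model n) [⋀^Fin k]→L[ℝ] ℝ :=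
  { f with cont := continuous_alternating f }

/-- The coordinate representation of `α` in the preferred chart at `p`, as a form on `ℝⁿ`. -/
def localRep {k : ℕ} (α : Form n M k) (p : M) (y : Model n) : (Model n) [⋀^Fin k]→L[ℝ] ℝ :=
  toCont ((α ((extChartAt (𝓡 n) p).symm y)).compLinearMap
    (mfderivWithin 𝓘(ℝ, Model n) (𝓡 n) (extChartAt (𝓡 n) p).symm (Set.range (𝓡 n)) y).toLinearMap)

/-- The exterior derivative at `p`: pull `α` back to `ℝⁿ` by the inverse of the preferred chart at
`p`, differentiate there, and pull the result back to `T_p M` by the chart. -/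
def extDAt {k : ℕ} (α : Form n M k) (p : M) : (Tan n p) [⋀^Fin (k + 1)]→ₗ[ℝ] ℝ :=
  (extDeriv (localRep α p) (extChartAt (𝓡 n) p p)).toAlternatingMap.compLinearMap
    (mfderiv (𝓡 n) 𝓘(ℝ, Model n) (extChartAt (𝓡 n) p) p).toLinearMap

theorem toCont_apply {k : ℕ} (f : (Model n) [⋀^Fin k]→ₗ[ℝ] ℝ) (v) : toCont f v = f v := rfl

theorem localRep_apply {k : ℕ} (α : Form n M k) (p : M) (y : Model n) (v : Fin k → Model n) :
    localRep α p y v = α ((extChartAt (𝓡 n) p).symm y) (fun i =>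
      mfderivWithin 𝓘(ℝ, Model n) (𝓡 n) (extChartAt (𝓡 n) p).symm (Set.range (𝓡 n)) y (v i)) :=
  rfl

theorem tendsto_symm (p : M) : Filter.Tendsto (extChartAt (𝓡 n) p).symm
    (nhds (extChartAt (𝓡 n) p p)) (nhds p) := by
  have h := continuousAt_extChartAt_symm (I := 𝓡 n) p
  rwa [ContinuousAt, extChartAt_to_inv] at h

theorem differentiableAt_comp_symm {f : M → ℝ} (hf : ContMDiff (𝓡 n) 𝓘(ℝ, ℝ) ∞ f) (p : M) :
    DifferentiableAt ℝ (f ∘ (extChartAt (𝓡 n) p).symm) (extChartAt (𝓡 n) p p) := by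
  have h := ((hf p).mdifferentiableAt (by simp)).mdifferentiableWithinAt (s := Set.univ)
  have h2 := MDifferentiableWithinAt.differentiableWithinAt_comp_extChartAt_symm h
  simpa [differentiableWithinAt_univ] using h2

variable [T2Space M]

theorem exists_coordField (p : M) (w : Model n) : ∃ W : VF n M, ∀ᶠ q in nhds p,
    W q = mfderivWithin 𝓘(ℝ, Model n) (𝓡 n) (extChartAt (𝓡 n) p).symm (Set.range (𝓡 n))
      (extChartAt (𝓡 n) p q) w := by
  set e := trivializationAt (Model n) (TangentSpace (𝓡 n) : M → Type _) p with he
  have h1 : ContMDiffOn (𝓡 n) ((𝓡 n).prod 𝓘(ℝ, Model n)) ∞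
      (fun q => Bundle.TotalSpace.mk' (Model n) q (e.symmL ℝ q w)) e.baseSet := by
    rw [e.contMDiffOn_section_baseSet_iff]
    apply (contMDiffOn_const (c := w)).congr
    intro y hy
    simp [hy]
  obtain ⟨χ⟩ : Nonempty (SmoothBumpFunction (𝓡 n) p) := inferInstance
  have h2 := ContMDiffOn.smul_section_of_tsupport (ψ := χ) χ.contMDiff.contMDiffOn e.open_baseSet
     (by simpa [e] using χ.tsupport_subset_chartAt_source) h1
  refine ⟨⟨_, h2⟩, ?_⟩
  filter_upwards [χ.eventuallyEq_one, chart_source_mem_nhds (Model n) p] with q hq hq'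
  rw [← TangentBundle.symmL_trivializationAt hq']
  change χ q • (e.symmL ℝ q w) = _
  rw [hq]
  exact one_smul ℝ _

theorem differentiableAt_localRep {k : ℕ} (α : Form n M k) (p : M) :
    DifferentiableAt ℝ (localRep α p) (extChartAt (𝓡 n) p p) := by
  let b := EuclideanSpace.basisFun (Fin n) ℝ
  let ev : ((Model n) [⋀^Fin k]→L[ℝ] ℝ) →ₗ[ℝ] ((Fin k → Fin n) → ℝ) :=
    { toFun := fun f r => f (fun i => b (r i))
      map_add' := fun _ _ => rfl
      map_smul' := fun _ _ => rfl }
  have hev : LinearMap.ker ev = ⊥ := by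
    rw [LinearMap.ker_eq_bot']
    intro f hf
    apply ContinuousAlternatingMap.toAlternatingMap_injective
    refine Module.Basis.ext_alternating b.toBasis fun r _ => ?_
    simpa [ev] using! congrFun hf r
  obtain ⟨g, hg⟩ := ev.exists_leftInverse_of_injective hev
  have key : localRep α p = fun y => g.toContinuousLinearMap (fun r => localRep α p y (fun i => b (r i))) := by
    funext y
    exact (LinearMap.congr_fun hg (localRep α p y)).symm
  rw [key]
  refine (ContinuousLinearMap.differentiableAt _).comp _ ?_
  rw [differentiableAt_pi]
  intro r
  choose W hW using fun i : Fin n => exists_coordField (n := n) p (b i)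
  refine (differentiableAt_comp_symm (α.smooth' fun i => W (r i)) p).congr_of_eventuallyEq ?_
  have hall : ∀ᶠ q in nhds p, ∀ i, W i q = mfderivWithin 𝓘(ℝ, Model n) (𝓡 n)
      (extChartAt (𝓡 n) p).symm (Set.range (𝓡 n)) (extChartAt (𝓡 n) p q) (b i) :=
    Filter.eventually_all.2 hW
  filter_upwards [(tendsto_symm p).eventually hall, extChartAt_target_mem_nhds (I := 𝓡 n) p] with y hy hy'
  rw [localRep_apply]
  simp only [Function.comp]
  congr 1
  funext i
  rw [hy (r i), (extChartAt (𝓡 n) p).right_inv hy']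

/-- The coordinate representation of a vector field in the preferred chart at `p`. -/
def hatField (p : M) (V : VF n M) : Model n → Model n :=
  VectorField.mpullbackWithin 𝓘(ℝ, Model n) (𝓡 n) (extChartAt (𝓡 n) p).symm V (Set.range (𝓡 n))

theorem differentiableAt_hatField (p : M) (V : VF n M) :
    DifferentiableAt ℝ (hatField p V) (extChartAt (𝓡 n) p p) := by
  have h := (V.mdifferentiableAt (x := p)).mdifferentiableWithinAt (s := Set.univ)
  have h2 : DifferentiableWithinAt ℝ (hatField p V) Set.univ (extChartAt (𝓡 n) p p) := by
    have := MDifferentiableWithinAt.differentiableWithinAt_mpullbackWithin_vectorField h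
    rw [Set.preimage_univ, Set.univ_inter] at this
    exact this.mono_of_mem_nhdsWithin (by simp)
  exact h2.differentiableAt Filter.univ_mem

theorem mfderiv_hatField (p : M) (V : VF n M) {y : Model n} (hy : y ∈ (extChartAt (𝓡 n) p).target) :
    mfderivWithin 𝓘(ℝ, Model n) (𝓡 n) (extChartAt (𝓡 n) p).symm (Set.range (𝓡 n)) y
      (hatField p V y) = V ((extChartAt (𝓡 n) p).symm y) :=
  (isInvertible_mfderivWithin_extChartAt_symm hy).self_apply_inverse _

theorem mfderiv_at (p : M) (v : Tan n p) : mfderiv (𝓡 n) 𝓘(ℝ, Model n) (extChartAt (𝓡 n) p) p v = v := by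
  rw [mfderiv_extChartAt_self]; rfl

theorem hatField_center (p : M) (V : VF n M) : hatField p V (extChartAt (𝓡 n) p p) = V p := by
  rw [hatField, VectorField.mpullbackWithin_apply, extChartAt_to_inv]
  exact mfderivWithin_extChartAt_symm_inverse_apply (V p)

theorem fderiv_comp_symm {f : M → ℝ} (hf : ContMDiff (𝓡 n) 𝓘(ℝ, ℝ) ∞ f) (p : M) (v : Tan n p) :
    fderiv ℝ (f ∘ (extChartAt (𝓡 n) p).symm) (extChartAt (𝓡 n) p p) v =
      mvfderiv (𝓡 n) f p v := by
  have h := (hf p).mdifferentiableAt (by simp)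
  simp [mvfderiv, mfderiv, h, fderivWithin_univ]
  rfl

/-- The Lie bracket of vector fields. -/
def lieBr (X Y : VF n M) : VF n M :=
  haveI : IsManifold (𝓡 n) (minSmoothness ℝ 2) M := by
    rw [minSmoothness_of_isRCLikeNormedField]; infer_instance
  haveI : IsManifold (𝓡 n) ((⊤ : ℕ∞) + 1) M := by
    rw [show (((⊤ : ℕ∞) : WithTop ℕ∞) + 1) = ∞ from rfl]; infer_instance
  ⟨VectorField.mlieBracket (𝓡 n) X Y, fun p =>
    ContMDiffAt.mlieBracket_vectorField (m := ⊤) (n := ⊤) (X.contMDiff p) (Y.contMDiff p) (by rw [minSmoothness_of_isRCLikeNormedField]; rfl)⟩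

theorem localRep_hat {k : ℕ} (α : Form n M k) (p : M) (V : Fin k → VF n M) :
    (fun y => localRep α p y (fun i => hatField p (V i) y)) =ᶠ[nhds (extChartAt (𝓡 n) p p)]
      (fun q => α q (fun i => V i q)) ∘ (extChartAt (𝓡 n) p).symm := by
  filter_upwards [extChartAt_target_mem_nhds (I := 𝓡 n) p] with y hy
  rw [localRep_apply]
  simp only [Function.comp]
  congr 1
  funext i
  exact mfderiv_hatField p (V i) hy

theorem localRep_center {k : ℕ} (α : Form n M k) (p : M) (v : Fin k → Tan n p) :
    localRep α p (extChartAt (𝓡 n) p p) v = α p v := by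
  change α ((extChartAt (𝓡 n) p).symm (extChartAt (𝓡 n) p p)) (fun i =>
    mfderivWithin 𝓘(ℝ, Model n) (𝓡 n) (extChartAt (𝓡 n) p).symm (Set.range (𝓡 n))
      (extChartAt (𝓡 n) p p) (v i)) = α p v
  rw [mfderivWithin_range_extChartAt_symm]
  change α ((extChartAt (𝓡 n) p).symm (extChartAt (𝓡 n) p p)) v = α p v
  rw [extChartAt_to_inv]

theorem lieBr_center (p : M) (X Y : VF n M) :
    VectorField.lieBracket ℝ (hatField p X) (hatField p Y) (extChartAt (𝓡 n) p p) = lieBr X Y p := by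
  have h : VectorField.mlieBracket (𝓡 n) X Y p =
      (ContinuousLinearMap.id ℝ (Model n)).inverse (VectorField.lieBracketWithin ℝ
        (hatField p X) (hatField p Y) Set.univ (extChartAt (𝓡 n) p p)) := by
    rw [← VectorField.mlieBracketWithin_univ, VectorField.mlieBracketWithin_apply,
      mfderiv_extChartAt_self, Set.preimage_univ, Set.univ_inter,
      show Set.range (𝓡 n) = Set.univ from ModelWithCorners.range_eq_univ _]
    unfold hatField
    rw [show Set.range (𝓡 n) = Set.univ from ModelWithCorners.range_eq_univ _]
    rfl
  rw [ContinuousLinearMap.inverse_id, VectorField.lieBracketWithin_univ] at h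
  exact h.symm

theorem extDAt_apply {k : ℕ} (α : Form n M k) (p : M) (V : Fin (k + 1) → VF n M) :
    extDAt α p (fun i => V i p) = extDeriv (localRep α p) (extChartAt (𝓡 n) p p)
      (fun i => hatField p (V i) (extChartAt (𝓡 n) p p)) := by
  simp only [hatField_center]
  change extDeriv (localRep α p) (extChartAt (𝓡 n) p p) (fun i => mfderiv (𝓡 n) 𝓘(ℝ, Model n) (extChartAt (𝓡 n) p) p (V i p)) = _
  simp only [mfderiv_at]

theorem extDAt_zero (α : Form n M 0) (p : M) (V : Fin 1 → VF n M) :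
    extDAt α p (fun i => V i p) =
      mvfderiv (𝓡 n) (fun q => α q (fun j => (Fin.elim0 j : VF n M) q)) p (V 0 p) := by
  have h : (fun y => localRep α p y
      ((0 : Fin 1).removeNth fun i => hatField p (V i) (extChartAt (𝓡 n) p p))) =
      fun y => localRep α p y (fun i => hatField p (Fin.elim0 i) y) := by
    funext y
    exact congrArg _ (Subsingleton.elim _ _)
  rw [extDAt_apply, extDeriv_apply (differentiableAt_localRep α p), Fin.sum_univ_one, h,
    ← fderiv_comp_symm (α.smooth' fun j => Fin.elim0 j), hatField_center,
    (localRep_hat α p fun j => Fin.elim0 j).fderiv_eq]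
  simp

theorem extDAt_succ {k : ℕ} (α : Form n M (k + 1)) (p : M) (V : Fin (k + 2) → VF n M) :
    extDAt α p (fun i => V i p) =
      (∑ i : Fin (k + 2), (-1) ^ (i : ℕ) •
        mvfderiv (𝓡 n) (fun q => α q (fun j => i.removeNth V j q)) p (V i p)) -
      ∑ i : Fin (k + 1), ∑ j ≥ i, (-1) ^ (i + j : ℕ) •
        α p (fun l => (Fin.cons (lieBr (V i.castSucc) (V j.succ)) (j.removeNth (i.castSucc.removeNth V)) : Fin (k + 1) → VF n M) l p) := by
  rw [extDAt_apply, extDeriv_apply_vectorField (differentiableAt_localRep α p) (fun i => differentiableAt_hatField p (V i))]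
  congr 1
  · refine Finset.sum_congr rfl fun i _ => ?_
    congr 1
    rw [← fderiv_comp_symm (α.smooth' _), hatField_center]
    rw [← (localRep_hat α p (i.removeNth V)).fderiv_eq]
    rfl
  · refine Finset.sum_congr rfl fun i _ => Finset.sum_congr rfl fun j _ => ?_
    congr 1
    rw [← localRep_center]
    congr 1
    funext l
    refine Fin.cases ?_ (fun l => ?_) l
    · exact lieBr_center p _ _
    · exact hatField_center p _

theorem contMDiff_dir {f : M → ℝ} (hf : ContMDiff (𝓡 n) 𝓘(ℝ, ℝ) ∞ f) (X : VF n M) :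
    ContMDiff (𝓡 n) 𝓘(ℝ, ℝ) ∞ (fun p => mvfderiv (𝓡 n) f p (X p)) := by
  have h := (hf.contMDiff_tangentMap (m := ∞) (by simp)).comp X.contMDiff
  exact (contMDiff_snd_tangentBundle_modelSpace ℝ 𝓘(ℝ, ℝ)).comp h


variable (n M) in
/-- The de Rham differential on `k`-forms. -/
def extD (k : ℕ) : Form n M k →ₗ[ℝ] Form n M (k + 1) where
  toFun α := ⟨extDAt α, fun V => by
    cases k with
    | zero =>
      simp only [extDAt_zero]
      exact contMDiff_dir (α.smooth' _) _
    | succ k =>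
      simp only [extDAt_succ]
      refine (contMDiff_finsetSum fun i _ => ?_).sub
        (contMDiff_finsetSum fun i _ => contMDiff_finsetSum fun j _ => ?_)
      · refine ((contMDiff_const (c := ((-1) ^ (i : ℕ) : ℝ))).mul
          (contMDiff_dir (α.smooth' (i.removeNth V)) (V i))).congr fun p => ?_
        rw [zsmul_eq_mul]
        push_cast
        rfl
      · refine ((contMDiff_const (c := ((-1) ^ (i + j : ℕ) : ℝ))).mul
          (α.smooth' (Fin.cons (lieBr (V i.castSucc) (V j.succ))
            (j.removeNth (i.castSucc.removeNth V))))).congr fun p => ?_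
        rw [zsmul_eq_mul]
        push_cast
        rfl⟩
  map_add' α β := Form.ext fun p => by
    have h : localRep (α + β) p = localRep α p + localRep β p := rfl
    change extDAt (α + β) p = extDAt α p + extDAt β p
    rw [extDAt, h, extDeriv_add (differentiableAt_localRep α p) (differentiableAt_localRep β p)]
    rfl
  map_smul' c α := Form.ext fun p => by
    have h : localRep (c • α) p = c • localRep α p := rfl
    change extDAt (c • α) p = c • extDAt α p
    rw [extDAt, h, extDeriv_smul]
    rfl

/-! ### Operators on differential forms -/

variable (n M) in
/-- All differential forms `Ω_M = ⨁ₖ Ω_M^k`. -/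
abbrev Forms : Type _ := DirectSum ℕ (fun k => Form n M k)

variable (n M) in
/-- The algebra of `ℝ`-linear operators on differential forms. -/
abbrev Op : Type _ := Module.End ℝ (Forms n M)

variable (n M) in
/-- The inclusion `Ω_M^k ⊆ Ω_M`. -/
abbrev incl (k : ℕ) : Form n M k →ₗ[ℝ] Forms n M :=
  DirectSum.lof ℝ ℕ (fun k => Form n M k) k

variable (n M) in
/-- The de Rham differential as an operator (of degree `1`). -/
def opD : Op n M :=
  DirectSum.toModule ℝ ℕ (Forms n M) fun k => incl n M (k + 1) ∘ₗ extD n M k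

/-- A smooth function as an operator (of degree `0`). -/
def opFun (f : C^∞⟮𝓡 n, M; 𝓘(ℝ, ℝ), ℝ⟯) : Op n M :=
  DirectSum.toModule ℝ ℕ (Forms n M) fun k => incl n M k ∘ₗ Form.mulFun f

/-- A vector field as an operator (of degree `-1`), acting by contraction. -/
def opVec (X : VF n M) : Op n M :=
  DirectSum.toModule ℝ ℕ (Forms n M) fun k =>
    match k with
    | 0 => 0
    | k + 1 => incl n M k ∘ₗ Form.contract X

/-- A `1`-form as an operator (of degree `1`), acting by left exterior multiplication. -/
def opOne (ξ : Form n M 1) : Op n M :=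
  DirectSum.toModule ℝ ℕ (Forms n M) fun k => incl n M (k + 1) ∘ₗ Form.wedge ξ

/-- The graded commutator `[A, B] = AB - (-1)^{ab} BA` of operators `A`, `B` of parities `a`, `b`. -/
def gradedComm (a b : ℕ) (A B : Op n M) : Op n M := A * B - ((-1 : ℝ) ^ (a * b)) • (B * A)

/-- The derived bracket `[[A, δ], B]` of odd operators `A`, `B` with respect to an odd operator
`δ`. -/
def derivedBracket (δ A B : Op n M) : Op n M := gradedComm 0 1 (gradedComm 1 1 A δ) B

/-- The adjoint action `B ↦ [A, B] = AB - BA` of an even operator `A`. -/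
def adEven (A : Op n M) : Module.End ℝ (Op n M) := LinearMap.mulLeft ℝ A - LinearMap.mulRight ℝ A

/-- An operator is even if it only has components of even degree. -/
def IsEvenOp (A : Op n M) : Prop :=
  ∀ (k : ℕ) (α : Form n M k) (j : ℕ), ¬ Even (j + k) → (A (incl n M k α)) j = 0

/-! ### The generalized tangent bundle -/

variable (n) in
/-- The fiber `T_p M ⊕ T_p^* M` of the generalized tangent bundle; covectors are regarded as
alternating forms in one variable. -/
abbrev GTan (p : M) : Type := Tan n p × ((Tan n p) [⋀^Fin 1]→ₗ[ℝ] ℝ)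

variable (n M) in
/-- Smooth sections `X + ξ` of the generalized tangent bundle. -/
abbrev GSec : Type _ := VF n M × Form n M 1

/-- The value of a section at a point. -/
def GSec.eval (x : GSec n M) (p : M) : GTan n p := (x.1 p, x.2 p)

/-- A section of the generalized tangent bundle as an operator: `α ↦ ι_X α + ξ ∧ α`. -/
def GSec.op (x : GSec n M) : Op n M := opVec x.1 + opOne x.2

/-- The tautological inner product `⟨X + ξ, Y + η⟩ = (ξ(Y) + η(X)) / 2`. -/
def pairing {p : M} (u v : GTan n p) : ℝ := (u.2 (fun _ => v.1) + v.2 (fun _ => u.1)) / 2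

/-- The Lie derivative of a `1`-form, `L_X η = ι_X dη + d(ι_X η)`. -/
def lieDeriv (X : VF n M) (β : Form n M 1) : Form n M 1 :=
  Form.contract X (extD n M 1 β) + extD n M 0 (Form.contract X β)

/-- The Dorfman bracket `⟦X + ξ, Y + η⟧ = [X, Y] + L_X η - ι_Y dξ`. -/
def dorfman (x y : GSec n M) : GSec n M :=
  (lieBr x.1 y.1, lieDeriv x.1 y.2 - Form.contract y.1 (extD n M 1 x.2))

variable (n M) in
/-- A smooth endomorphism of the generalized tangent bundle: a family of linear endomorphisms of
the fibers which maps smooth sections to smooth sections. -/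
structure BundleEndo : Type _ where
  fiber : ∀ p : M, Module.End ℝ (GTan n p)
  smooth' : ∀ x : GSec n M, ∃ y : GSec n M, ∀ p, y.eval p = fiber p (x.eval p)

/-- The action of a bundle endomorphism on smooth sections. -/
def BundleEndo.apply (φ : BundleEndo n M) (x : GSec n M) : GSec n M := (φ.smooth' x).choose

theorem BundleEndo.eval_apply (φ : BundleEndo n M) (x : GSec n M) (p : M) :
    (φ.apply x).eval p = φ.fiber p (x.eval p) := (φ.smooth' x).choose_spec p

/-- Skew-symmetry with respect to the tautological inner product. -/
def BundleEndo.IsSkew (φ : BundleEndo n M) : Prop :=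
  ∀ (p : M) (u v : GTan n p), pairing (φ.fiber p u) v + pairing u (φ.fiber p v) = 0

/-- `φ` is a generalized polynomial structure with minimal polynomial `P`; its degree is
`P.natDegree`. -/
def IsGenPolyStructure (φ : BundleEndo n M) (P : Polynomial ℝ) : Prop :=
  φ.IsSkew ∧ P.Monic ∧ 0 < P.natDegree ∧ ∀ p : M, minpoly ℝ (φ.fiber p) = P

/-! ### Torsions -/

/-- The Courant-Nijenhuis torsion
`φ²⟦x, y⟧ + ⟦φ x, φ y⟧ - φ(⟦φ x, y⟧ + ⟦x, φ y⟧)`. -/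
def courantNijenhuis (φ : BundleEndo n M) (x y : GSec n M) : GSec n M :=
  φ.apply (φ.apply (dorfman x y)) + dorfman (φ.apply x) (φ.apply y) -
    φ.apply (dorfman (φ.apply x) y + dorfman x (φ.apply y))

/-- The shifted Courant-Nijenhuis torsion. -/
def shiftedCourantNijenhuis (φ : BundleEndo n M) (x y : GSec n M) : GSec n M :=
  courantNijenhuis φ (φ.apply x) y + courantNijenhuis φ x (φ.apply y)

/-- Generalized Nijenhuis operators. -/
def IsGenNijenhuis (φ : BundleEndo n M) : Prop :=
  ∀ x y : GSec n M, courantNijenhuis φ x y = 0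

/-- Weak generalized Nijenhuis operators. -/
def IsWeakGenNijenhuis (φ : BundleEndo n M) : Prop :=
  ∀ x y : GSec n M, shiftedCourantNijenhuis φ x y = 0

/-- `A` is the lift of `φ` to operators on differential forms: it is even, commutes with functions,
satisfies `[A, x] = φ x` for all sections `x`, and maps `1` to a `2`-form. -/
def IsLift (φ : BundleEndo n M) (A : Op n M) : Prop :=
  IsEvenOp A ∧ (∀ f, gradedComm 0 0 A (opFun f) = 0) ∧
    (∀ x : GSec n M, gradedComm 0 1 A x.op = (φ.apply x).op) ∧
    ∃ ε : Form n M 2, A (incl n M 0 Form.one) = incl n M 2 ε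

/-- The minimal operator `P(ad_A)(d)`, where `A` is the lift of an endomorphism with minimal
polynomial `P`. -/
def minimalOp (A : Op n M) (P : Polynomial ℝ) : Op n M :=
  Polynomial.aeval (adEven A) P (opD n M)

/-- The endomorphism `φ` with minimal polynomial `P` is minimal: it has a (necessarily unique) lift
to operators on differential forms, and its minimal torsion, the derived bracket of sections with
respect to the minimal operator, vanishes. -/
def IsMinimal (φ : BundleEndo n M) (P : Polynomial ℝ) : Prop :=
  ∃ A : Op n M, IsLift φ A ∧
    ∀ x y : GSec n M, derivedBracket (minimalOp A P) x.op y.op = 0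

end GenGeom

end

/-!
Let `A` be the lift of `φ` and `D = d` the de Rham differential. For an odd operator `D` write
`B_D(x, y) = [[x, D], y]`. For `D = d` this derived bracket is the Dorfman bracket, represented by
operators (`derivedForm_opD`). Since `[A, ·]` is a derivation of graded commutators and
`[A, x] = φ x`, one has `B_{[A, D]} = (L - R - S) B_D`, where `L` applies `[A, ·]` to the value of a
bilinear map and `R`, `S` apply `φ` to its first and second argument. Therefore
`B_{P(ad_A) d} = P(L - R - S) B_d` (`derivedForm_aeval`), and it remains to see that the right hand
side vanishes. The operators `L`, `R`, `S` commute, and the Nijenhuis condition says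
`(L - R) (L - S) B_d = 0`, the weak one `(L - R) (L - S) (R + S) B_d = 0`.

* In any commutative algebra `(l - r) (l - s)` divides `P(l - r - s) + P(-l) - P(-r) - P(-s)`
  (`dvd_aeval_sub_sub`). As `φ` is skew-symmetric, the adjoint of `P(φ) = 0` is `P(-φ)`, which
  vanishes too, so that `P(-L)`, `P(-R)`, `P(-S)` annihilate `B_d`; for `P(-L)` this uses that the
  values of `B_d` are sections of the generalized tangent bundle. This proves the first part.
* If `P` has odd degree, then `P(-φ) = 0` and minimality give `P(-x) = -P(x)`
  (`coeff_minpoly_eq_zero_of_skew`), and for odd `P` even `(l - r) (l - s) (r + s)` divides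
  `P(l - r - s) - P(l) - P(-r) - P(-s)` (`dvd_aeval_sub_sub_of_odd`). This proves the second part.

That `B_d` is the Dorfman bracket is Cartan calculus. The formula `[L_X, ι_Y] = ι_[X,Y]` is computed
in the chart at a point; the remaining commutators are obtained from it, since an operator of
positive degree commuting up to sign with all contractions is zero (`eq_zero_of_comm_opVec`).

The lift of `φ` is the spin lift `½ ∑ᵢ (φ(wᵢ) eᵢ + φ(eᵢ) wᵢ - eᵢ(φ(wᵢ)))`, for a frame `wᵢ` of the
tangent space with dual coframe `eᵢ`, where products are taken in the Clifford algebra acting on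
forms. It does not depend on the frame (`fiberLift_eq`), so the formulas for local frames define an
operator on all forms (`exists_op_of_local`).
-/

set_option maxSynthPendingDepth 3

noncomputable section

namespace GenGeom

/-! ### The Clifford action on the exterior algebra of a vector space -/

section Fiber

variable {V : Type*} [AddCommGroup V] [Module ℝ V] {k : ℕ}

/-- Insertion of a fixed vector in the first slot of an alternating map. -/
def insertVec (v : V) : (V [⋀^Fin (k + 1)]→ₗ[ℝ] ℝ) →ₗ[ℝ] (V [⋀^Fin k]→ₗ[ℝ] ℝ) where
  toFun α := α.curryLeft v
  map_add' _ _ := rfl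
  map_smul' _ _ := rfl

theorem insertVec_apply (v : V) (α : V [⋀^Fin (k + 1)]→ₗ[ℝ] ℝ) (u : Fin k → V) :
    insertVec v α u = α (Fin.cons v u) := rfl

/-- The linear functional underlying an alternating `1`-form. -/
def toDual (ξ : V [⋀^Fin 1]→ₗ[ℝ] ℝ) : V →ₗ[ℝ] ℝ :=
  (AlternatingMap.ofSubsingleton ℝ V ℝ (0 : Fin 1)).symm ξ

theorem toDual_apply (ξ : V [⋀^Fin 1]→ₗ[ℝ] ℝ) (v : V) : toDual ξ v = ξ fun _ => v := rfl

/-- Left exterior multiplication by a `1`-form. -/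
def wedgeOne (ξ : V [⋀^Fin 1]→ₗ[ℝ] ℝ) :
    (V [⋀^Fin k]→ₗ[ℝ] ℝ) →ₗ[ℝ] (V [⋀^Fin (k + 1)]→ₗ[ℝ] ℝ) where
  toFun α := AlternatingMap.alternatizeUncurryFin (LinearMap.smulRight (toDual ξ) α)
  map_add' α β := by
    ext v
    simp [AlternatingMap.alternatizeUncurryFin_apply, Finset.sum_add_distrib, smul_add]
  map_smul' c α := by
    ext v
    simp [AlternatingMap.alternatizeUncurryFin_apply, Finset.mul_sum, mul_left_comm]

theorem wedgeOne_apply (ξ : V [⋀^Fin 1]→ₗ[ℝ] ℝ) (α : V [⋀^Fin k]→ₗ[ℝ] ℝ) :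
    wedgeOne ξ α = AlternatingMap.alternatizeUncurryFin (LinearMap.smulRight (toDual ξ) α) := rfl

theorem insertVec_alternatize_zero (x : V) (A : V →ₗ[ℝ] (V [⋀^Fin 0]→ₗ[ℝ] ℝ)) :
    insertVec x (AlternatingMap.alternatizeUncurryFin A) = A x := by
  ext v
  rw [insertVec_apply, AlternatingMap.alternatizeUncurryFin_apply]
  simp [Subsingleton.elim _ v]

/-- Inserting a vector into the first slot of an alternatization splits off the first summand. -/
theorem insertVec_alternatize_succ (x : V) (A : V →ₗ[ℝ] (V [⋀^Fin (k + 1)]→ₗ[ℝ] ℝ)) :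
    insertVec x (AlternatingMap.alternatizeUncurryFin A) =
      A x - AlternatingMap.alternatizeUncurryFin (insertVec x ∘ₗ A) := by
  ext v
  rw [insertVec_apply, AlternatingMap.alternatizeUncurryFin_apply, Fin.sum_univ_succ,
    AlternatingMap.sub_apply, AlternatingMap.alternatizeUncurryFin_apply, sub_eq_add_neg,
    ← Finset.sum_neg_distrib]
  congr 1
  · simp [Fin.removeNth_zero]
  · refine Finset.sum_congr rfl fun i _ => ?_
    have h : (i.succ.removeNth (Fin.cons x v : Fin (k + 2) → V)) = Fin.cons x (i.removeNth v) := by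
      funext j
      refine Fin.cases ?_ (fun j => ?_) j <;> simp [Fin.removeNth]
    rw [h]
    simp [pow_succ, insertVec_apply]

theorem insertVec_anticomm (v w : V) (α : V [⋀^Fin (k + 2)]→ₗ[ℝ] ℝ) :
    insertVec v (insertVec w α) + insertVec w (insertVec v α) = 0 := by
  have h := α.curryLeft_same (v + w)
  have h1 := α.curryLeft_same v
  have h2 := α.curryLeft_same w
  ext u
  have h' := DFunLike.congr_fun h u
  have h1' := DFunLike.congr_fun h1 u
  have h2' := DFunLike.congr_fun h2 u
  simp only [AlternatingMap.curryLeft_add, map_add, LinearMap.add_apply,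
    AlternatingMap.add_apply, AlternatingMap.zero_apply] at h' h1' h2'
  change (α.curryLeft w).curryLeft v u + (α.curryLeft v).curryLeft w u = 0
  linarith

theorem wedgeOne_add_left (ξ η : V [⋀^Fin 1]→ₗ[ℝ] ℝ) (α : V [⋀^Fin k]→ₗ[ℝ] ℝ) :
    wedgeOne (ξ + η) α = wedgeOne ξ α + wedgeOne η α := by
  simp only [wedgeOne_apply]
  rw [← AlternatingMap.alternatizeUncurryFin_add]
  congr 1
  ext x : 1
  exact add_smul _ _ _

theorem insertVec_wedgeOne_zero (x : V) (ξ : V [⋀^Fin 1]→ₗ[ℝ] ℝ) (α : V [⋀^Fin 0]→ₗ[ℝ] ℝ) :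
    insertVec x (wedgeOne ξ α) = toDual ξ x • α := by
  rw [wedgeOne_apply, insertVec_alternatize_zero]; rfl

theorem insertVec_wedgeOne_succ (x : V) (ξ : V [⋀^Fin 1]→ₗ[ℝ] ℝ)
    (α : V [⋀^Fin (k + 1)]→ₗ[ℝ] ℝ) :
    insertVec x (wedgeOne ξ α) = toDual ξ x • α - wedgeOne ξ (insertVec x α) := by
  rw [wedgeOne_apply, insertVec_alternatize_succ, wedgeOne_apply]
  congr 2

theorem wedgeOne_anticomm (ξ η : V [⋀^Fin 1]→ₗ[ℝ] ℝ) (α : V [⋀^Fin k]→ₗ[ℝ] ℝ) :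
    wedgeOne ξ (wedgeOne η α) + wedgeOne η (wedgeOne ξ α) = 0 := by
  let F : V →ₗ[ℝ] V →ₗ[ℝ] (V [⋀^Fin k]→ₗ[ℝ] ℝ) :=
    LinearMap.smulRight (toDual ξ) (LinearMap.smulRight (toDual η) α) +
      LinearMap.smulRight (toDual η) (LinearMap.smulRight (toDual ξ) α)
  have hF : ∀ x y, F x y = F y x := by
    intro x y
    simp [F, smul_smul, mul_comm, add_comm]
  rw [← AlternatingMap.alternatizeUncurryFin_alternatizeUncurryFinLM_comp_of_symmetric hF,
    wedgeOne_apply, wedgeOne_apply (ξ := η) (α := wedgeOne ξ α),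
    ← AlternatingMap.alternatizeUncurryFin_add]
  congr 1
  ext x : 1
  simp [F, wedgeOne_apply]

variable (V) in
/-- The exterior algebra of alternating forms on a vector space, as a graded vector space. -/
abbrev FiberForms : Type _ :=
  DirectSum ℕ fun k => V [⋀^Fin k]→ₗ[ℝ] ℝ

variable (V) in
/-- The inclusion of the forms of degree `k`. -/
abbrev fiberIncl (k : ℕ) : (V [⋀^Fin k]→ₗ[ℝ] ℝ) →ₗ[ℝ] FiberForms V :=
  DirectSum.lof ℝ ℕ (fun k => V [⋀^Fin k]→ₗ[ℝ] ℝ) k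

/-- Insertion of a vector as an operator on all alternating forms. -/
def fiberVec (v : V) : Module.End ℝ (FiberForms V) :=
  DirectSum.toModule ℝ ℕ (FiberForms V) fun k =>
    match k with
    | 0 => 0
    | k + 1 => fiberIncl V k ∘ₗ insertVec v

/-- Exterior multiplication by a `1`-form as an operator on all alternating forms. -/
def fiberOne (ξ : V [⋀^Fin 1]→ₗ[ℝ] ℝ) : Module.End ℝ (FiberForms V) :=
  DirectSum.toModule ℝ ℕ (FiberForms V) fun k => fiberIncl V (k + 1) ∘ₗ wedgeOne ξ

theorem fiberVec_incl_zero (v : V) (α : V [⋀^Fin 0]→ₗ[ℝ] ℝ) :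
    fiberVec v (fiberIncl V 0 α) = 0 := by
  rw [fiberVec, DirectSum.toModule_lof]; rfl

theorem fiberVec_incl_succ (v : V) (α : V [⋀^Fin (k + 1)]→ₗ[ℝ] ℝ) :
    fiberVec v (fiberIncl V (k + 1) α) = fiberIncl V k (insertVec v α) := by
  rw [fiberVec, DirectSum.toModule_lof]; rfl

theorem fiberOne_incl (ξ : V [⋀^Fin 1]→ₗ[ℝ] ℝ) (α : V [⋀^Fin k]→ₗ[ℝ] ℝ) :
    fiberOne ξ (fiberIncl V k α) = fiberIncl V (k + 1) (wedgeOne ξ α) := by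
  rw [fiberOne, DirectSum.toModule_lof]; rfl

theorem fiberEnd_ext {A B : Module.End ℝ (FiberForms V)}
    (h : ∀ k α, A (fiberIncl V k α) = B (fiberIncl V k α)) : A = B :=
  DirectSum.linearMap_ext ℝ fun k => LinearMap.ext (h k)

theorem fiberVec_anticomm (v w : V) : fiberVec v * fiberVec w + fiberVec w * fiberVec v = 0 := by
  refine fiberEnd_ext fun k α => ?_
  simp only [LinearMap.add_apply, Module.End.mul_apply, LinearMap.zero_apply]
  match k, α with
  | 0, α => simp only [fiberVec_incl_zero, map_zero, add_zero]
  | 1, α => simp only [fiberVec_incl_succ, fiberVec_incl_zero, add_zero]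
  | k + 2, α => simp only [fiberVec_incl_succ]; rw [← map_add, insertVec_anticomm, map_zero]

theorem fiberOne_anticomm (ξ η : V [⋀^Fin 1]→ₗ[ℝ] ℝ) :
    fiberOne ξ * fiberOne η + fiberOne η * fiberOne ξ = 0 := by
  refine fiberEnd_ext fun k α => ?_
  simp only [LinearMap.add_apply, Module.End.mul_apply, LinearMap.zero_apply, fiberOne_incl]
  rw [← map_add, wedgeOne_anticomm, map_zero]

theorem fiberVec_fiberOne (v : V) (ξ : V [⋀^Fin 1]→ₗ[ℝ] ℝ) :
    fiberVec v * fiberOne ξ + fiberOne ξ * fiberVec v = toDual ξ v • 1 := by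
  refine fiberEnd_ext fun k α => ?_
  simp only [LinearMap.add_apply, Module.End.mul_apply, LinearMap.smul_apply, Module.End.one_apply,
    fiberOne_incl, fiberVec_incl_succ]
  match k, α with
  | 0, α => rw [fiberVec_incl_zero, insertVec_wedgeOne_zero, map_zero, add_zero, map_smul]
  | k + 1, α =>
    rw [fiberVec_incl_succ, fiberOne_incl, insertVec_wedgeOne_succ, ← map_add, sub_add_cancel,
      map_smul]

/-- The Clifford action of `V ⊕ V*` on the alternating forms. -/
def clifford : (V × (V [⋀^Fin 1]→ₗ[ℝ] ℝ)) →ₗ[ℝ] Module.End ℝ (FiberForms V) where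
  toFun u := fiberVec u.1 + fiberOne u.2
  map_add' u w := by
    refine fiberEnd_ext fun k α => ?_
    have h1 : fiberVec (u.1 + w.1) (fiberIncl V k α) =
        fiberVec u.1 (fiberIncl V k α) + fiberVec w.1 (fiberIncl V k α) := by
      match k, α with
      | 0, α => simp only [fiberVec_incl_zero, add_zero]
      | k + 1, α =>
        simp only [fiberVec_incl_succ]
        rw [← map_add]
        congr 1
        exact map_add α.curryLeft u.1 w.1
    simp only [Prod.fst_add, Prod.snd_add, LinearMap.add_apply, fiberOne_incl, h1,
      wedgeOne_add_left, map_add]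
    abel
  map_smul' c u := by
    refine fiberEnd_ext fun k α => ?_
    have h1 : fiberVec (c • u.1) (fiberIncl V k α) = c • fiberVec u.1 (fiberIncl V k α) := by
      match k, α with
      | 0, α => simp only [fiberVec_incl_zero, smul_zero]
      | k + 1, α =>
        simp only [fiberVec_incl_succ]
        rw [← map_smul]
        congr 1
        exact map_smul α.curryLeft c u.1
    have h2 : wedgeOne (c • u.2) α = c • wedgeOne u.2 α := by
      simp only [wedgeOne_apply]
      rw [← AlternatingMap.alternatizeUncurryFin_smul]
      congr 1
      ext x : 1
      exact smul_assoc c (toDual u.2 x) α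
    simp only [Prod.smul_fst, Prod.smul_snd, LinearMap.add_apply, LinearMap.smul_apply,
      fiberOne_incl, h1, h2, map_smul, smul_add, RingHom.id_apply]

theorem clifford_apply (u : V × (V [⋀^Fin 1]→ₗ[ℝ] ℝ)) :
    clifford u = fiberVec u.1 + fiberOne u.2 := rfl

/-- Twice the tautological inner product on `V ⊕ V*`. -/
def dualPairing (u w : V × (V [⋀^Fin 1]→ₗ[ℝ] ℝ)) : ℝ := toDual u.2 w.1 + toDual w.2 u.1

/-- The operators `clifford u` represent the Clifford algebra of `V ⊕ V*`. -/
theorem clifford_relation (u w : V × (V [⋀^Fin 1]→ₗ[ℝ] ℝ)) :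
    clifford u * clifford w + clifford w * clifford u = dualPairing u w • 1 := by
  have h1 := fiberVec_anticomm u.1 w.1
  have h2 := fiberOne_anticomm u.2 w.2
  have h3 := fiberVec_fiberOne u.1 w.2
  have h4 := fiberVec_fiberOne w.1 u.2
  rw [dualPairing, add_smul, ← h3, ← h4, clifford_apply, clifford_apply]
  linear_combination (norm := noncomm_ring) h1 + h2

/-! ### The spin lift of a skew-symmetric endomorphism on a fibre -/

theorem toDual_add (ξ η : V [⋀^Fin 1]→ₗ[ℝ] ℝ) : toDual (ξ + η) = toDual ξ + toDual η := rfl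

theorem toDual_smul (c : ℝ) (ξ : V [⋀^Fin 1]→ₗ[ℝ] ℝ) : toDual (c • ξ) = c • toDual ξ := rfl

theorem alt_one_ext {ξ η : V [⋀^Fin 1]→ₗ[ℝ] ℝ} (h : ∀ v, toDual ξ v = toDual η v) : ξ = η :=
  (AlternatingMap.ofSubsingleton ℝ V ℝ (0 : Fin 1)).symm.injective (LinearMap.ext h)

variable {ι κ : Type*} [Fintype ι] [Fintype κ]

/-- The vectors `w i` and the covectors `e i` are dual in the sense that `∑ eᵢ(v) wᵢ = v`. -/
def IsDualFrame (w : ι → V) (e : ι → V [⋀^Fin 1]→ₗ[ℝ] ℝ) : Prop :=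
  ∀ v, ∑ i, toDual (e i) v • w i = v

theorem IsDualFrame.sum_covector {w : ι → V} {e : ι → V [⋀^Fin 1]→ₗ[ℝ] ℝ} (h : IsDualFrame w e)
    (ξ : V [⋀^Fin 1]→ₗ[ℝ] ℝ) : ∑ i, toDual ξ (w i) • e i = ξ := by
  refine alt_one_ext fun v => ?_
  have h1 : toDual (∑ i, toDual ξ (w i) • e i) v = ∑ i, toDual ξ (w i) * toDual (e i) v := by
    let L : (V [⋀^Fin 1]→ₗ[ℝ] ℝ) →ₗ[ℝ] ℝ := ⟨⟨fun η => toDual η v, fun _ _ => rfl⟩, fun _ _ => rfl⟩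
    exact map_sum L _ _
  rw [h1]
  conv_rhs => rw [← h v, map_sum]
  exact Finset.sum_congr rfl fun i _ => by rw [map_smul, smul_eq_mul, mul_comm]

/-- The contraction of a bilinear expression over a frame and its dual coframe does not depend on
the frame. -/
theorem IsDualFrame.sum_eq {W : Type*} [AddCommGroup W] [Module ℝ W]
    (F : V →ₗ[ℝ] (V [⋀^Fin 1]→ₗ[ℝ] ℝ) →ₗ[ℝ] W)
    {w : ι → V} {e : ι → V [⋀^Fin 1]→ₗ[ℝ] ℝ} (h : IsDualFrame w e)
    {w' : κ → V} {e' : κ → V [⋀^Fin 1]→ₗ[ℝ] ℝ} (h' : IsDualFrame w' e') :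
    ∑ i, F (w i) (e i) = ∑ j, F (w' j) (e' j) := by
  have h1 : ∀ i, F (w i) (e i) = ∑ j, toDual (e' j) (w i) • F (w' j) (e i) := fun i => by
    conv_lhs => rw [← h' (w i)]
    simp only [map_sum, map_smul, LinearMap.sum_apply, LinearMap.smul_apply]
  simp only [h1]
  rw [Finset.sum_comm]
  refine Finset.sum_congr rfl fun j _ => ?_
  conv_rhs => rw [← h.sum_covector (e' j), map_sum]
  simp only [map_smul]

variable (ψ : Module.End ℝ (V × (V [⋀^Fin 1]→ₗ[ℝ] ℝ)))

/-- The summand `ψ(v) ξ + ψ(ξ) v - ξ(ψ(v))` of the spin lift; the last term removes the part of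
degree `0`. -/
def liftTerm : V →ₗ[ℝ] (V [⋀^Fin 1]→ₗ[ℝ] ℝ) →ₗ[ℝ] Module.End ℝ (FiberForms V) :=
  LinearMap.mk₂ ℝ (fun v ξ => clifford (ψ (v, 0)) * clifford (0, ξ) +
      clifford (ψ (0, ξ)) * clifford (v, 0) - toDual ξ (ψ (v, 0)).1 • 1)
    (fun v v' ξ => by
      rw [show ((v + v', 0) : V × (V [⋀^Fin 1]→ₗ[ℝ] ℝ)) = (v, 0) + (v', 0) by simp]
      simp only [map_add, Prod.fst_add, add_mul, mul_add, add_smul]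
      abel)
    (fun c v ξ => by
      rw [show ((c • v, 0) : V × (V [⋀^Fin 1]→ₗ[ℝ] ℝ)) = c • (v, 0) by simp]
      simp only [map_smul, Prod.smul_fst, smul_mul_assoc, mul_smul_comm, smul_sub, smul_add,
        smul_eq_mul, mul_smul])
    (fun v ξ ξ' => by
      rw [show ((0, ξ + ξ') : V × (V [⋀^Fin 1]→ₗ[ℝ] ℝ)) = (0, ξ) + (0, ξ') by simp]
      simp only [map_add, toDual_add, LinearMap.add_apply, add_mul, mul_add, add_smul]
      abel)
    (fun c v ξ => by
      rw [show ((0, c • ξ) : V × (V [⋀^Fin 1]→ₗ[ℝ] ℝ)) = c • (0, ξ) by simp]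
      simp only [map_smul, toDual_smul, LinearMap.smul_apply, smul_mul_assoc, mul_smul_comm,
        smul_sub, smul_add, smul_eq_mul, mul_smul])

theorem liftTerm_apply (v : V) (ξ : V [⋀^Fin 1]→ₗ[ℝ] ℝ) :
    liftTerm ψ v ξ = clifford (ψ (v, 0)) * clifford (0, ξ) +
      clifford (ψ (0, ξ)) * clifford (v, 0) - toDual ξ (ψ (v, 0)).1 • 1 := rfl

/-- The spin lift `½ ∑ᵢ (ψ(wᵢ) eᵢ + ψ(eᵢ) wᵢ - eᵢ(ψ(wᵢ)))` of an endomorphism `ψ` of `V ⊕ V*`. -/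
def fiberLift (w : ι → V) (e : ι → V [⋀^Fin 1]→ₗ[ℝ] ℝ) : Module.End ℝ (FiberForms V) :=
  (1 / 2 : ℝ) • ∑ i, liftTerm ψ (w i) (e i)

/-- The spin lift does not depend on the frame, which is what allows gluing local formulas. -/
theorem fiberLift_eq {w : ι → V} {e : ι → V [⋀^Fin 1]→ₗ[ℝ] ℝ} (h : IsDualFrame w e)
    {w' : κ → V} {e' : κ → V [⋀^Fin 1]→ₗ[ℝ] ℝ} (h' : IsDualFrame w' e') :
    fiberLift ψ w e = fiberLift ψ w' e' := by
  rw [fiberLift, fiberLift, h.sum_eq _ h']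

theorem clifford_mul_comm (a b x : V × (V [⋀^Fin 1]→ₗ[ℝ] ℝ)) :
    clifford a * clifford b * clifford x - clifford x * (clifford a * clifford b) =
      dualPairing b x • clifford a - dualPairing a x • clifford b := by
  have h1 := congrArg (clifford a * ·) (clifford_relation b x)
  have h2 := congrArg (· * clifford b) (clifford_relation a x)
  simp only [mul_smul_comm, smul_mul_assoc, mul_one, one_mul] at h1 h2
  rw [← h1, ← h2]
  noncomm_ring

theorem IsDualFrame.sum_pairing {w : ι → V} {e : ι → V [⋀^Fin 1]→ₗ[ℝ] ℝ} (h : IsDualFrame w e)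
    (x : V × (V [⋀^Fin 1]→ₗ[ℝ] ℝ)) :
    ∑ i, (dualPairing (0, e i) x • (w i, (0 : V [⋀^Fin 1]→ₗ[ℝ] ℝ)) +
      dualPairing (w i, 0) x • ((0 : V), e i)) = x := by
  have h1 : ∀ i, dualPairing (0, e i) x = toDual (e i) x.1 := fun i => by
    simp [dualPairing]
  have h2 : ∀ i, dualPairing (w i, 0) x = toDual x.2 (w i) := fun i => by
    simp [dualPairing, toDual_apply]
  simp only [h1, h2, Prod.smul_mk, smul_zero, Prod.mk_add_mk, add_zero, zero_add]
  refine Prod.ext ?_ ?_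
  · rw [Prod.fst_sum]; exact h x.1
  · rw [Prod.snd_sum]; exact h.sum_covector x.2

/-- The spin lift of a skew-symmetric `ψ` implements `ψ` by commutators. For `a = ψ(wᵢ)`, `b = eᵢ` the
Clifford relations turn the commutator with `x` into `⟨b, x⟩ a - ⟨a, x⟩ b`; skew-symmetry moves `ψ`
from `a` to `x`, and the sum over the frame gives `ψ(x)` twice. -/
theorem fiberLift_comm (hψ : ∀ u v, dualPairing (ψ u) v = -dualPairing u (ψ v))
    {w : ι → V} {e : ι → V [⋀^Fin 1]→ₗ[ℝ] ℝ} (h : IsDualFrame w e)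
    (x : V × (V [⋀^Fin 1]→ₗ[ℝ] ℝ)) :
    fiberLift ψ w e * clifford x - clifford x * fiberLift ψ w e = clifford (ψ x) := by
  have h1 : ∀ i, liftTerm ψ (w i) (e i) * clifford x - clifford x * liftTerm ψ (w i) (e i) =
      clifford (ψ (dualPairing (0, e i) x • (w i, 0) + dualPairing (w i, 0) x • (0, e i))) +
      clifford (dualPairing (0, e i) (ψ x) • (w i, 0) +
        dualPairing (w i, 0) (ψ x) • (0, e i)) := by
    intro i
    have e1 := clifford_mul_comm (ψ (w i, 0)) (0, e i) x
    have e2 := clifford_mul_comm (ψ (0, e i)) (w i, 0) x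
    simp only [map_add, map_smul]
    rw [hψ] at e1 e2
    rw [liftTerm_apply, sub_mul, mul_sub, add_mul, mul_add, smul_mul_assoc, mul_smul_comm, one_mul,
      mul_one]
    linear_combination (norm := module) e1 + e2
  -- The sum over `i` of the arguments of `ψ`, resp. of `clifford`, is `x`, resp. `ψ x`.
  have h2 : (∑ i, liftTerm ψ (w i) (e i)) * clifford x -
      clifford x * (∑ i, liftTerm ψ (w i) (e i)) = (2 : ℝ) • clifford (ψ x) := by
    rw [Finset.sum_mul, Finset.mul_sum, ← Finset.sum_sub_distrib,
      Finset.sum_congr rfl fun i _ => h1 i, Finset.sum_add_distrib,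
      ← map_sum, ← map_sum, ← map_sum, h.sum_pairing, h.sum_pairing, ← two_smul ℝ]
  rw [fiberLift, smul_mul_assoc, mul_smul_comm]
  linear_combination (norm := module) (1 / 2 : ℝ) • h2

variable (V) in
/-- The parity involution `α ↦ (-1)ᵏ α` for `α` of degree `k`. -/
def fiberParity : Module.End ℝ (FiberForms V) :=
  DirectSum.toModule ℝ ℕ (FiberForms V) fun k => ((-1 : ℝ) ^ k) • fiberIncl V k

theorem fiberParity_incl (α : V [⋀^Fin k]→ₗ[ℝ] ℝ) :
    fiberParity V (fiberIncl V k α) = ((-1 : ℝ) ^ k) • fiberIncl V k α := by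
  rw [fiberParity, DirectSum.toModule_lof]; rfl

theorem fiberParity_apply (α : FiberForms V) (j : ℕ) :
    (fiberParity V α) j = ((-1 : ℝ) ^ j) • α j := by
  have h : (DirectSum.component ℝ ℕ (fun k => V [⋀^Fin k]→ₗ[ℝ] ℝ) j) ∘ₗ fiberParity V =
      ((-1 : ℝ) ^ j) • DirectSum.component ℝ ℕ (fun k => V [⋀^Fin k]→ₗ[ℝ] ℝ) j := by
    refine DirectSum.linearMap_ext ℝ fun k => LinearMap.ext fun α => ?_
    simp only [LinearMap.comp_apply, LinearMap.smul_apply]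
    rw [fiberParity_incl, map_smul]
    by_cases hk : k = j
    · subst hk; rfl
    · rw [DirectSum.component.of, dif_neg hk, smul_zero, smul_zero]
  exact LinearMap.congr_fun h α

theorem fiberParity_clifford (x : V × (V [⋀^Fin 1]→ₗ[ℝ] ℝ)) :
    fiberParity V * clifford x + clifford x * fiberParity V = 0 := by
  refine fiberEnd_ext fun k α => ?_
  simp only [Module.End.mul_apply, LinearMap.zero_apply, fiberParity_incl, clifford_apply,
    LinearMap.add_apply, map_add, fiberOne_incl, map_smul]
  match k, α with
  | 0, α => rw [fiberVec_incl_zero]; simp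
  | k + 1, α => rw [fiberVec_incl_succ, fiberParity_incl]; rw [pow_succ]; module

/-- The spin lift is a sum of products of two odd operators and of scalars, hence it is even. -/
theorem fiberLift_parity (w : ι → V) (e : ι → V [⋀^Fin 1]→ₗ[ℝ] ℝ) :
    fiberParity V * fiberLift ψ w e = fiberLift ψ w e * fiberParity V := by
  have h2 : ∀ a b : V × (V [⋀^Fin 1]→ₗ[ℝ] ℝ), fiberParity V * (clifford a * clifford b) =
      clifford a * clifford b * fiberParity V := fun a b => by
    linear_combination (norm := noncomm_ring)
      fiberParity_clifford a * clifford b - clifford a * fiberParity_clifford b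
  simp only [fiberLift, smul_mul_assoc, mul_smul_comm, Finset.sum_mul, Finset.mul_sum,
    liftTerm_apply, sub_mul, mul_sub, add_mul, mul_add, h2, one_mul, mul_one]

theorem fiberLift_even (w : ι → V) (e : ι → V [⋀^Fin 1]→ₗ[ℝ] ℝ) {j : ℕ} (hjk : ¬ Even (j + k))
    (α : V [⋀^Fin k]→ₗ[ℝ] ℝ) : (fiberLift ψ w e (fiberIncl V k α)) j = 0 := by
  have h := LinearMap.congr_fun (fiberLift_parity ψ w e) (fiberIncl V k α)
  simp only [Module.End.mul_apply, fiberParity_incl, map_smul] at h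
  have h' := congrArg (fun β : FiberForms V => β j) h
  simp only [fiberParity_apply] at h'
  change _ = ((-1 : ℝ) ^ k) • (fiberLift ψ w e (fiberIncl V k α)) j at h'
  have hne : (-1 : ℝ) ^ j ≠ (-1) ^ k := fun h0 => by
    have h3 := (Nat.not_even_iff_odd.1 hjk).neg_one_pow (α := ℝ)
    rw [pow_add, h0, ← pow_add, ← two_mul, pow_mul] at h3
    norm_num at h3
  by_contra hne'
  exact hne (smul_left_injective ℝ hne' h')

/-- The spin lift maps constants to `2`-forms. -/
theorem fiberLift_const (w : ι → V) (e : ι → V [⋀^Fin 1]→ₗ[ℝ] ℝ) (α : V [⋀^Fin 0]→ₗ[ℝ] ℝ) :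
    fiberLift ψ w e (fiberIncl V 0 α) = fiberIncl V 2
      ((1 / 2 : ℝ) • ∑ i, wedgeOne (ψ (w i, 0)).2 (wedgeOne (e i) α)) := by
  have h : ∀ i, liftTerm ψ (w i) (e i) (fiberIncl V 0 α) =
      fiberIncl V 2 (wedgeOne (ψ (w i, 0)).2 (wedgeOne (e i) α)) := by
    intro i
    have h0 : wedgeOne (0 : V [⋀^Fin 1]→ₗ[ℝ] ℝ) α = 0 := by
      rw [wedgeOne_apply]
      ext v
      simp [AlternatingMap.alternatizeUncurryFin_apply, toDual_apply]
    have h1 : clifford (0, e i) (fiberIncl V 0 α) = fiberIncl V 1 (wedgeOne (e i) α) := by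
      rw [clifford_apply, LinearMap.add_apply, fiberVec_incl_zero, zero_add, fiberOne_incl]
    have h2 : clifford (w i, 0) (fiberIncl V 0 α) = 0 := by
      rw [clifford_apply, LinearMap.add_apply, fiberVec_incl_zero, zero_add, fiberOne_incl, h0,
        map_zero]
    rw [liftTerm_apply, LinearMap.sub_apply, LinearMap.add_apply, Module.End.mul_apply,
      Module.End.mul_apply, h1, h2, map_zero, add_zero, clifford_apply, LinearMap.add_apply,
      fiberOne_incl, fiberVec_incl_succ, insertVec_wedgeOne_zero]
    simp
  rw [fiberLift, LinearMap.smul_apply, LinearMap.sum_apply, Finset.sum_congr rfl fun i _ => h i,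
    ← map_sum, ← map_smul]

end Fiber

/-! ### Divisibility of polynomials in commuting variables -/

section Divisibility

open Polynomial

/-- The expression vanishes for `a = -c` and for `b = -c`. -/
theorem dvd_add_pow_add_neg_pow {K : Type*} [CommRing K] (a b c : K) :
    ∀ k : ℕ, (a + c) * (b + c) ∣ (a + b + c) ^ k + (-c) ^ k - a ^ k - b ^ k
  | 0 => by simp
  | 1 => by simp
  | k + 2 => by
    have h0 := dvd_add_pow_add_neg_pow a b c k
    have h1 := dvd_add_pow_add_neg_pow a b c (k + 1)
    -- The power sums `pₖ` of two variables satisfy `pₖ₊₂ = (x + y) pₖ₊₁ - x y pₖ`.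
    rw [show (a + b + c) ^ (k + 2) + (-c) ^ (k + 2) - a ^ (k + 2) - b ^ (k + 2) =
      (a + b) * ((a + b + c) ^ (k + 1) + (-c) ^ (k + 1) - a ^ (k + 1) - b ^ (k + 1)) -
      (a + b + c) * (-c) * ((a + b + c) ^ k + (-c) ^ k - a ^ k - b ^ k) +
      (a + c) * (b + c) * (a ^ k + b ^ k) by ring]
    exact dvd_add (dvd_sub (h1.mul_left _) (h0.mul_left _)) (dvd_mul_right _ _)

/-- The expression vanishes whenever two of the variables are opposite. -/
theorem dvd_add_pow_odd {K : Type*} [CommRing K] (a b c : K) :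
    ∀ m : ℕ, (a + b) * (a + c) * (b + c) ∣
      (a + b + c) ^ (2 * m + 1) - a ^ (2 * m + 1) - b ^ (2 * m + 1) - c ^ (2 * m + 1)
  | 0 => by ring_nf; exact dvd_zero _
  | m + 1 => by
    have h0 := dvd_add_pow_odd a b c m
    have hab : a + b ∣ a ^ (2 * m + 1) + b ^ (2 * m + 1) := Odd.add_dvd_pow_add_pow a b ⟨m, rfl⟩
    have hac : a + c ∣ a ^ (2 * m + 1) + c ^ (2 * m + 1) := Odd.add_dvd_pow_add_pow a c ⟨m, rfl⟩
    have hbc : b + c ∣ b ^ (2 * m + 1) + c ^ (2 * m + 1) := Odd.add_dvd_pow_add_pow b c ⟨m, rfl⟩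
    -- Multiply by `(a + b + c)²` and use `(a + b + c)² - a² = (b + c) ((a + b) + (a + c))`.
    rw [show (a + b + c) ^ (2 * (m + 1) + 1) - a ^ (2 * (m + 1) + 1) - b ^ (2 * (m + 1) + 1) -
        c ^ (2 * (m + 1) + 1) =
      (a + b + c) ^ 2 * ((a + b + c) ^ (2 * m + 1) - a ^ (2 * m + 1) - b ^ (2 * m + 1) -
        c ^ (2 * m + 1)) + ((a + c) * (b + c) * (a ^ (2 * m + 1) + b ^ (2 * m + 1)) +
        (a + b) * (b + c) * (a ^ (2 * m + 1) + c ^ (2 * m + 1)) +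
        (a + b) * (a + c) * (b ^ (2 * m + 1) + c ^ (2 * m + 1))) by ring]
    refine dvd_add (h0.mul_left _) (dvd_add (dvd_add ?_ ?_) ?_)
    · rw [show (a + b) * (a + c) * (b + c) = (a + c) * (b + c) * (a + b) by ring]
      exact mul_dvd_mul_left _ hab
    · rw [show (a + b) * (a + c) * (b + c) = (a + b) * (b + c) * (a + c) by ring]
      exact mul_dvd_mul_left _ hac
    · exact mul_dvd_mul_left _ hbc

variable (P : ℝ[X])

/-- The polynomial identity behind the Nijenhuis case: `l`, `r`, `s` stand for the adjoint action on
the value of the derived bracket and for the action of `φ` on its two arguments. -/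
theorem dvd_aeval_sub_sub {K : Type*} [CommRing K] [Algebra ℝ K] (l r s : K) :
    (l - r) * (l - s) ∣
      aeval (l - r - s) P + aeval (-l) P - aeval (-r) P - aeval (-s) P := by
  simp only [aeval_eq_sum_range, ← Finset.sum_add_distrib, ← Finset.sum_sub_distrib,
    ← smul_add, ← smul_sub]
  refine Finset.dvd_sum fun k _ => dvd_smul_of_dvd _ ?_
  have h := dvd_add_pow_add_neg_pow (-r) (-s) l k
  rwa [show (-r + l) * (-s + l) = (l - r) * (l - s) by ring,
    show -r + -s + l = l - r - s by ring] at h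

/-- For an odd polynomial the additional factor `r + s` splits off, which accounts for the shift in
the weak Nijenhuis condition. -/
theorem dvd_aeval_sub_sub_of_odd {K : Type*} [CommRing K] [Algebra ℝ K]
    (hP : ∀ k, Even k → P.coeff k = 0) (l r s : K) :
    (l - r) * (l - s) * (r + s) ∣
      aeval (l - r - s) P - aeval l P - aeval (-r) P - aeval (-s) P := by
  simp only [aeval_eq_sum_range, ← Finset.sum_sub_distrib, ← smul_sub]
  refine Finset.dvd_sum fun k _ => ?_
  rcases Nat.even_or_odd k with hk | ⟨m, rfl⟩
  · rw [hP k hk, zero_smul]; exact dvd_zero _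
  · refine dvd_smul_of_dvd _ ?_
    have h := dvd_add_pow_odd l (-r) (-s) m
    rw [show (l + -r) * (l + -s) * (-r + -s) = -((l - r) * (l - s) * (r + s)) by ring,
      show l + -r + -s = l - r - s by ring, neg_dvd] at h
    exact h

universe u

variable {E : Type u} [AddCommGroup E] [Module ℝ E]

open scoped IsMulCommutative in
/-- Three commuting operators lie in the image of a commutative algebra, so that divisibilities valid
in all commutative algebras apply to them. -/
theorem exists_commRing_lift {l r s : Module.End ℝ E} (hlr : Commute l r) (hls : Commute l s)
    (hrs : Commute r s) : ∃ (K : Type u) (_ : CommRing K) (_ : Algebra ℝ K)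
      (f : K →ₐ[ℝ] Module.End ℝ E) (l' r' s' : K), f l' = l ∧ f r' = r ∧ f s' = s := by
  have hcomm : ∀ a ∈ ({l, r, s} : Set (Module.End ℝ E)), ∀ b ∈ ({l, r, s} : Set (Module.End ℝ E)),
      a * b = b * a := by
    rintro a (rfl | rfl | rfl) b (rfl | rfl | rfl)
    exacts [rfl, hlr, hls, hlr.symm, rfl, hrs, hls.symm, hrs.symm, rfl]
  have := Algebra.isMulCommutative_adjoin ℝ hcomm
  refine ⟨Algebra.adjoin ℝ {l, r, s}, inferInstance,
    (Algebra.adjoin ℝ {l, r, s}).algebra, (Algebra.adjoin ℝ {l, r, s}).val,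
    ⟨l, Algebra.subset_adjoin (by simp)⟩, ⟨r, Algebra.subset_adjoin (by simp)⟩,
    ⟨s, Algebra.subset_adjoin (by simp)⟩, rfl, rfl, rfl⟩

/-- If commuting operators satisfy `(l - r) (l - s) b = 0` and `P(-x) b = 0` for each of the three,
then `P(l - r - s) b = 0`. -/
theorem aeval_sub_sub_apply_eq_zero {l r s : Module.End ℝ E} (hlr : Commute l r)
    (hls : Commute l s) (hrs : Commute r s) {b : E} (hb : ((l - r) * (l - s)) b = 0)
    (hl : aeval (-l) P b = 0) (hr : aeval (-r) P b = 0) (hs : aeval (-s) P b = 0) :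
    aeval (l - r - s) P b = 0 := by
  obtain ⟨K, _, _, f, l, r, s, rfl, rfl, rfl⟩ := exists_commRing_lift hlr hls hrs
  obtain ⟨q, hq⟩ := dvd_aeval_sub_sub P l r s
  have h := congrArg (fun a => f a b) hq
  rw [mul_comm _ q] at h
  simp only [map_sub, map_add, map_mul, ← aeval_algHom_apply, map_neg, LinearMap.add_apply,
    LinearMap.sub_apply, hl, hr, hs, add_zero, sub_zero] at h
  rw [h, Module.End.mul_apply, hb, map_zero]

/-- If commuting operators satisfy `(l - r) (l - s) (r + s) b = 0`, and `P` is odd with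
`P(l) b = P(-r) b = P(-s) b = 0`, then `P(l - r - s) b = 0`. -/
theorem aeval_sub_sub_apply_eq_zero_of_odd (hP : ∀ k, Even k → P.coeff k = 0)
    {l r s : Module.End ℝ E} (hlr : Commute l r)
    (hls : Commute l s) (hrs : Commute r s) {b : E} (hb : ((l - r) * (l - s) * (r + s)) b = 0)
    (hl : aeval l P b = 0) (hr : aeval (-r) P b = 0) (hs : aeval (-s) P b = 0) :
    aeval (l - r - s) P b = 0 := by
  obtain ⟨K, _, _, f, l, r, s, rfl, rfl, rfl⟩ := exists_commRing_lift hlr hls hrs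
  obtain ⟨q, hq⟩ := dvd_aeval_sub_sub_of_odd P hP l r s
  have h := congrArg (fun a => f a b) hq
  rw [mul_comm _ q] at h
  simp only [map_sub, map_add, map_mul, ← aeval_algHom_apply, map_neg,
    LinearMap.sub_apply, hl, hr, hs, sub_zero] at h
  rw [h, Module.End.mul_apply, hb, map_zero]

/-- Transport of polynomials along a linear map that intertwines the powers of `f` with `g`. -/
theorem aeval_apply_of_intertwine {R : Type*} [Ring R] [Algebra ℝ R] (T : R →ₗ[ℝ] E) {f : R}
    {g : Module.End ℝ E} (h : ∀ k : ℕ, g (T (f ^ k)) = T (f ^ (k + 1))) :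
    aeval g P (T 1) = T (aeval f P) := by
  have hk : ∀ k : ℕ, (g ^ k) (T 1) = T (f ^ k) := fun k => by
    induction k with
    | zero => simp
    | succ k ih => rw [pow_succ', Module.End.mul_apply, ih, h]
  simp only [aeval_eq_sum_range, LinearMap.sum_apply, LinearMap.smul_apply, hk, map_sum, map_smul]

end Divisibility

/-! ### Derived brackets and polynomials in the adjoint action -/

section Derived

open Polynomial

variable {E F : Type*} [AddCommGroup E] [Module ℝ E] [AddCommGroup F] [Module ℝ F]

variable (E) in
/-- Composition of a bilinear map with an endomorphism of the target. -/
def postComp (A : Module.End ℝ F) : Module.End ℝ (E →ₗ[ℝ] E →ₗ[ℝ] F) where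
  toFun b := b.compr₂ A
  map_add' _ _ := by ext; simp
  map_smul' _ _ := by ext; simp

variable (F) in
/-- Composition of a bilinear map with an endomorphism in the first argument. -/
def preLeft (f : Module.End ℝ E) : Module.End ℝ (E →ₗ[ℝ] E →ₗ[ℝ] F) where
  toFun b := b ∘ₗ f
  map_add' _ _ := by ext; simp
  map_smul' _ _ := by ext; simp

variable (F) in
/-- Composition of a bilinear map with an endomorphism in the second argument. -/
def preRight (f : Module.End ℝ E) : Module.End ℝ (E →ₗ[ℝ] E →ₗ[ℝ] F) where
  toFun b := b.compl₂ f
  map_add' _ _ := by ext; simp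
  map_smul' _ _ := by ext; simp

theorem postComp_apply (A : Module.End ℝ F) (b : E →ₗ[ℝ] E →ₗ[ℝ] F) (x y : E) :
    postComp E A b x y = A (b x y) := rfl

theorem preLeft_apply (f : Module.End ℝ E) (b : E →ₗ[ℝ] E →ₗ[ℝ] F) (x y : E) :
    preLeft F f b x y = b (f x) y := rfl

theorem preRight_apply (f : Module.End ℝ E) (b : E →ₗ[ℝ] E →ₗ[ℝ] F) (x y : E) :
    preRight F f b x y = b x (f y) := rfl

variable (P : ℝ[X])

theorem aeval_preLeft_apply (f : Module.End ℝ E) (b : E →ₗ[ℝ] E →ₗ[ℝ] F) (x y : E) :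
    aeval (preLeft F f) P b x y = b (aeval f P x) y := by
  let T : Module.End ℝ E →ₗ[ℝ] (E →ₗ[ℝ] E →ₗ[ℝ] F) :=
    ⟨⟨fun h => b ∘ₗ h, fun _ _ => by ext; simp⟩, fun _ _ => by ext; simp⟩
  have h := aeval_apply_of_intertwine P T (f := f) (g := preLeft F f) fun k => by
    ext x y
    rw [pow_succ]
    rfl
  exact LinearMap.congr_fun₂ h x y

theorem aeval_preRight_apply (f : Module.End ℝ E) (b : E →ₗ[ℝ] E →ₗ[ℝ] F) (x y : E) :
    aeval (preRight F f) P b x y = b x (aeval f P y) := by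
  let T : Module.End ℝ E →ₗ[ℝ] (E →ₗ[ℝ] E →ₗ[ℝ] F) :=
    ⟨⟨fun h => b.compl₂ h, fun _ _ => by ext; simp⟩, fun _ _ => by ext; simp⟩
  have h := aeval_apply_of_intertwine P T (f := f) (g := preRight F f) fun k => by
    ext x y
    rw [pow_succ]
    rfl
  exact LinearMap.congr_fun₂ h x y

theorem aeval_postComp_apply (A : Module.End ℝ F) (b : E →ₗ[ℝ] E →ₗ[ℝ] F) (x y : E) :
    aeval (postComp E A) P b x y = aeval A P (b x y) := by
  let T : Module.End ℝ F →ₗ[ℝ] (E →ₗ[ℝ] E →ₗ[ℝ] F) :=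
    ⟨⟨fun h => b.compr₂ h, fun _ _ => by ext; simp⟩, fun _ _ => by ext; simp⟩
  have h := aeval_apply_of_intertwine P T (f := A) (g := postComp E A) fun k => by
    ext x y
    rw [pow_succ']
    rfl
  exact LinearMap.congr_fun₂ h x y

variable {R : Type*} [Ring R] [Algebra ℝ R]

/-- The derived bracket `(x, y) ↦ [[x, D], y]` of odd elements with respect to an odd element `D`,
for elements `x`, `y` given by a linear map `c`. -/
def derivedForm (c : E →ₗ[ℝ] R) : R →ₗ[ℝ] E →ₗ[ℝ] E →ₗ[ℝ] R where
  toFun D := LinearMap.mk₂ ℝ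
    (fun x y => (c x * D + D * c x) * c y - c y * (c x * D + D * c x))
    (fun _ _ _ => by simp only [map_add]; noncomm_ring)
    (fun _ _ _ => by
      simp only [map_smul, smul_mul_assoc, mul_smul_comm, ← smul_add, ← smul_sub])
    (fun _ _ _ => by simp only [map_add]; noncomm_ring)
    (fun _ _ _ => by
      simp only [map_smul, smul_mul_assoc, mul_smul_comm, ← smul_sub])
  map_add' _ _ := by
    ext; simp only [LinearMap.mk₂_apply, LinearMap.add_apply]; noncomm_ring
  map_smul' _ _ := by
    ext
    simp only [LinearMap.mk₂_apply, LinearMap.smul_apply, smul_mul_assoc, mul_smul_comm,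
      ← smul_add, ← smul_sub, RingHom.id_apply]

theorem derivedForm_apply (c : E →ₗ[ℝ] R) (D : R) (x y : E) :
    derivedForm c D x y = (c x * D + D * c x) * c y - c y * (c x * D + D * c x) := rfl

/-- The commutator with an element, as a linear map. -/
def commutator (A : R) : Module.End ℝ R := LinearMap.mulLeft ℝ A - LinearMap.mulRight ℝ A

theorem commutator_apply (A B : R) : commutator A B = A * B - B * A := rfl

variable {c : E →ₗ[ℝ] R} {A : R} {f : Module.End ℝ E}

/-- The commutator with `A` is a derivation, so bracketing with `[A, D]` in place of `D` amounts to
applying `ad_A` to the bracket and subtracting the brackets with `f` in one of the arguments. These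
three operations commute, and `P(ad_A)` becomes `P` of their combination. -/
theorem derivedForm_aeval (hA : ∀ x, A * c x - c x * A = c (f x)) (D : R) :
    derivedForm c (aeval (commutator A) P D) =
      aeval (postComp E (commutator A) - preLeft R f - preRight R f) P (derivedForm c D) := by
  let T : Module.End ℝ R →ₗ[ℝ] (E →ₗ[ℝ] E →ₗ[ℝ] R) :=
    ⟨⟨fun h => derivedForm c (h D), fun _ _ => by simp⟩, fun _ _ => by simp⟩
  have key : ∀ B, (postComp E (commutator A) - preLeft R f - preRight R f) (derivedForm c B) =
      derivedForm c (commutator A B) := fun B => by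
    ext x y
    simp only [LinearMap.sub_apply, postComp_apply, preLeft_apply, preRight_apply,
      derivedForm_apply, commutator_apply, ← hA]
    noncomm_ring
  exact (aeval_apply_of_intertwine P T (f := commutator A) fun k => by
    rw [pow_succ']; exact key _).symm

theorem commute_postComp_preLeft (B : Module.End ℝ F) (f : Module.End ℝ E) :
    Commute (postComp E B) (preLeft F f : Module.End ℝ (E →ₗ[ℝ] E →ₗ[ℝ] F)) := rfl

theorem commute_postComp_preRight (B : Module.End ℝ F) (f : Module.End ℝ E) :
    Commute (postComp E B) (preRight F f : Module.End ℝ (E →ₗ[ℝ] E →ₗ[ℝ] F)) := rfl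

theorem commute_preLeft_preRight (f g : Module.End ℝ E) :
    Commute (preLeft F f) (preRight F g : Module.End ℝ (E →ₗ[ℝ] E →ₗ[ℝ] F)) := rfl

theorem neg_preLeft (f : Module.End ℝ E) :
    -(preLeft F f : Module.End ℝ (E →ₗ[ℝ] E →ₗ[ℝ] F)) = preLeft F (-f) := by
  ext; simp [preLeft_apply]

theorem neg_preRight (f : Module.End ℝ E) :
    -(preRight F f : Module.End ℝ (E →ₗ[ℝ] E →ₗ[ℝ] F)) = preRight F (-f) := by
  ext; simp [preRight_apply]

theorem neg_postComp (B : Module.End ℝ F) :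
    -(postComp E B : Module.End ℝ (E →ₗ[ℝ] E →ₗ[ℝ] F)) = postComp E (-B) := by
  ext; simp [postComp_apply]

/-- On the image of `c`, a polynomial in `± ad_A` is computed by the same polynomial in `± f`. -/
theorem aeval_smul_commutator_apply (hA : ∀ x, A * c x - c x * A = c (f x)) (t : ℝ) (x : E) :
    aeval (t • commutator A) P (c x) = c (aeval (t • f) P x) := by
  let T : Module.End ℝ E →ₗ[ℝ] R :=
    ⟨⟨fun h => c (h x), fun _ _ => by simp⟩, fun _ _ => by simp⟩
  exact aeval_apply_of_intertwine P T (f := t • f) (g := t • commutator A) fun k => by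
    rw [pow_succ']
    change t • (A * c _ - c _ * A) = c (t • f _)
    rw [hA, map_smul]

variable {br : E → E → E} {D : R}

/-- If the derived bracket with respect to `D` is `br`, the endomorphism `f` satisfies the Nijenhuis
condition for `br`, and `P(-f) = 0`, then the derived bracket with respect to `P(ad_A) D`
vanishes. -/
theorem derivedForm_eq_zero_of_nijenhuis (hA : ∀ x, A * c x - c x * A = c (f x))
    (hD : ∀ x y, derivedForm c D x y = c (br x y)) (hP : aeval (-f) P = 0)
    (hN : ∀ x y, f (f (br x y)) + br (f x) (f y) - f (br (f x) y + br x (f y)) = 0) :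
    derivedForm c (aeval (commutator A) P D) = 0 := by
  rw [derivedForm_aeval P hA]
  refine aeval_sub_sub_apply_eq_zero P (commute_postComp_preLeft (commutator A) f)
    (commute_postComp_preRight (commutator A) f) (commute_preLeft_preRight f f) ?_ ?_ ?_ ?_
  · ext x y
    simp only [Module.End.mul_apply, LinearMap.sub_apply, postComp_apply, preLeft_apply,
      preRight_apply, hD, LinearMap.zero_apply, commutator_apply, hA, mul_sub, sub_mul]
    rw [← map_zero c, ← hN x y]
    simp only [map_add, map_sub, ← hA]
    noncomm_ring
  · ext x y
    have h := aeval_smul_commutator_apply P hA (-1) (br x y)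
    rw [neg_one_smul, neg_one_smul] at h
    rw [neg_postComp, aeval_postComp_apply, hD, h, hP]
    simp
  · ext x y
    rw [neg_preLeft, aeval_preLeft_apply, hP]
    simp
  · ext x y
    rw [neg_preRight, aeval_preRight_apply, hP]
    simp

/-- The weak Nijenhuis condition suffices if `P` is odd. -/
theorem derivedForm_eq_zero_of_weakNijenhuis (hA : ∀ x, A * c x - c x * A = c (f x))
    (hD : ∀ x y, derivedForm c D x y = c (br x y)) (hodd : ∀ k, Even k → P.coeff k = 0)
    (hP : aeval f P = 0) (hP' : aeval (-f) P = 0)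
    {T : E → E → E}
    (hT : ∀ x y, T x y = f (f (br x y)) + br (f x) (f y) - f (br (f x) y + br x (f y)))
    (hN : ∀ x y, T (f x) y + T x (f y) = 0) :
    derivedForm c (aeval (commutator A) P D) = 0 := by
  rw [derivedForm_aeval P hA]
  refine aeval_sub_sub_apply_eq_zero_of_odd P hodd (commute_postComp_preLeft (commutator A) f)
    (commute_postComp_preRight (commutator A) f) (commute_preLeft_preRight f f) ?_ ?_ ?_ ?_
  · ext x y
    simp only [Module.End.mul_apply, LinearMap.sub_apply, LinearMap.add_apply, postComp_apply,
      preLeft_apply, preRight_apply, hD, LinearMap.zero_apply, commutator_apply]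
    rw [← map_zero c, ← hN x y, hT, hT]
    simp only [map_add, map_sub, ← hA]
    noncomm_ring
  · ext x y
    have h := aeval_smul_commutator_apply P hA 1 (br x y)
    rw [one_smul, one_smul] at h
    rw [aeval_postComp_apply, hD, h, hP]
    simp
  · ext x y
    rw [neg_preLeft, aeval_preLeft_apply, hP']
    simp
  · ext x y
    rw [neg_preRight, aeval_preRight_apply, hP']
    simp

end Derived

section Chart

variable {n : ℕ} {M : Type*} [TopologicalSpace M] [ChartedSpace (Model n) M]
  [IsManifold (𝓡 n) ∞ M] {k : ℕ}

/-! ### The exterior derivative in the chart at a point -/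

/-- The derivative at `p` of the coefficients of a form in the preferred chart at `p`. -/
def chartD (α : Form n M k) (p : M) : Tan n p →ₗ[ℝ] ((Tan n p) [⋀^Fin k]→ₗ[ℝ] ℝ) where
  toFun v := (fderiv ℝ (localRep α p) (extChartAt (𝓡 n) p p) v).toAlternatingMap
  map_add' v w := congrArg ContinuousAlternatingMap.toAlternatingMap (map_add (fderiv ℝ _ _) v w)
  map_smul' c v :=
    congrArg ContinuousAlternatingMap.toAlternatingMap (map_smul (fderiv ℝ _ _) c v)

/-- The derivative at `p` of a vector field in the preferred chart at `p`. -/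
def chartDVec (X : VF n M) (p : M) : Tan n p →ₗ[ℝ] Tan n p :=
  (fderiv ℝ (hatField p X) (extChartAt (𝓡 n) p p)).toLinearMap

variable [T2Space M]

/-- The exterior derivative is the alternatization of the derivative of the coefficients in the
chart. -/
theorem extD_apply_eq (α : Form n M k) (p : M) :
    extD n M k α p = AlternatingMap.alternatizeUncurryFin (chartD α p) := by
  ext u
  refine (congrArg (extDeriv (localRep α p) (extChartAt (𝓡 n) p p))
    (funext fun i => mfderiv_at p (u i))).trans ?_
  exact DFunLike.congr_fun (ContinuousAlternatingMap.toAlternatingMap_alternatizeUncurryFin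
    (fderiv ℝ (localRep α p) (extChartAt (𝓡 n) p p))) u

theorem chartD_contract (X : VF n M) (α : Form n M (k + 1)) (p : M) (v : Tan n p) :
    chartD (Form.contract X α) p v =
      insertVec (X p) (chartD α p v) + insertVec (chartDVec X p v) (α p) := by
  let c := ContinuousAlternatingMap.curryLeftLI (𝕜 := ℝ) (E := Model n) (F := ℝ) (n := k)
  have h1 : localRep (Form.contract X α) p =ᶠ[nhds (extChartAt (𝓡 n) p p)]
      fun y => (c.toContinuousLinearMap (localRep α p y)) (hatField p X y) := by
    filter_upwards [extChartAt_target_mem_nhds (I := 𝓡 n) p] with y hy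
    ext u
    change Form.contract X α _ _ = localRep α p y (Fin.cons (hatField p X y) u)
    rw [localRep_apply]
    change α _ (Fin.cons _ _) = _
    congr 1
    funext i
    refine Fin.cases ?_ (fun i => ?_) i
    · exact (mfderiv_hatField p X hy).symm
    · rfl
  have h2 := (c.toContinuousLinearMap.hasFDerivAt.comp _
    (differentiableAt_localRep α p).hasFDerivAt).clm_apply (differentiableAt_hatField p X).hasFDerivAt
  have h3 := (h2.congr_of_eventuallyEq h1).fderiv
  ext u
  change fderiv ℝ (localRep (Form.contract X α) p) (extChartAt (𝓡 n) p p) v u = _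
  rw [h3]
  change localRep α p (extChartAt (𝓡 n) p p) (Fin.cons (chartDVec X p v) u) +
    fderiv ℝ (localRep α p) (extChartAt (𝓡 n) p p) v
      (Fin.cons (hatField p X (extChartAt (𝓡 n) p p)) u) = _
  rw [add_comm]
  exact congrArg₂ (· + ·)
    (congrArg (fun w => fderiv ℝ (localRep α p) (extChartAt (𝓡 n) p p) v (Fin.cons w u))
      (hatField_center p X))
    (localRep_center α p (Fin.cons (chartDVec X p v) u : Fin (k + 1) → Tan n p))

/-- The differential at `p` of a smooth function in the preferred chart at `p`. -/
def chartDFun (f : C^∞⟮𝓡 n, M; 𝓘(ℝ, ℝ), ℝ⟯) (p : M) : Tan n p →ₗ[ℝ] ℝ :=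
  (fderiv ℝ (f ∘ (extChartAt (𝓡 n) p).symm) (extChartAt (𝓡 n) p p)).toLinearMap

theorem chartD_mulFun (f : C^∞⟮𝓡 n, M; 𝓘(ℝ, ℝ), ℝ⟯) (α : Form n M k) (p : M) (v : Tan n p) :
    chartD (Form.mulFun f α) p v = f p • chartD α p v + chartDFun f p v • α p := by
  have h2 := (differentiableAt_comp_symm f.contMDiff p).hasFDerivAt.smul
    (differentiableAt_localRep α p).hasFDerivAt
  have h3 : fderiv ℝ (localRep (Form.mulFun f α) p) (extChartAt (𝓡 n) p p) = _ := h2.fderiv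
  ext u
  change fderiv ℝ (localRep (Form.mulFun f α) p) (extChartAt (𝓡 n) p p) v u = _
  rw [h3]
  change f ((extChartAt (𝓡 n) p).symm (extChartAt (𝓡 n) p p)) * chartD α p v u +
    chartDFun f p v * localRep α p (extChartAt (𝓡 n) p p) u = _
  rw [localRep_center, extChartAt_to_inv]
  rfl

theorem chartD_one (p : M) : chartD (Form.one : Form n M 0) p = 0 := by
  have h : localRep (Form.one : Form n M 0) p =
      fun _ => toCont (AlternatingMap.constOfIsEmpty ℝ (Model n) (Fin 0) 1) := rfl
  ext v u
  change fderiv ℝ (localRep Form.one p) (extChartAt (𝓡 n) p p) v u = 0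
  rw [h, fderiv_const_apply]
  rfl

variable (n M) in
/-- The differential of a smooth function, as a `1`-form. -/
def diff (f : C^∞⟮𝓡 n, M; 𝓘(ℝ, ℝ), ℝ⟯) : Form n M 1 := extD n M 0 (Form.mulFun f Form.one)

theorem toDual_diff (f : C^∞⟮𝓡 n, M; 𝓘(ℝ, ℝ), ℝ⟯) (p : M) :
    toDual (diff n M f p) = chartDFun f p := by
  ext v
  have h : insertVec v (diff n M f p) = chartDFun f p v • (Form.one : Form n M 0) p := by
    rw [diff, extD_apply_eq, insertVec_alternatize_zero, chartD_mulFun, chartD_one]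
    simp
  have h' := DFunLike.congr_fun h (Fin.elim0 : Fin 0 → Tan n p)
  rw [insertVec_apply] at h'
  rw [toDual_apply]
  convert h' using 2
  · funext i
    rw [Subsingleton.elim i 0]
    rfl
  · exact (mul_one _).symm

/-- The Leibniz rule `d(f α) = f dα + df ∧ α`. -/
theorem extD_mulFun (f : C^∞⟮𝓡 n, M; 𝓘(ℝ, ℝ), ℝ⟯) (α : Form n M k) :
    extD n M k (Form.mulFun f α) =
      Form.mulFun f (extD n M k α) + Form.wedge (diff n M f) α := by
  refine Form.ext fun p => ?_
  have h : chartD (Form.mulFun f α) p =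
      f p • chartD α p + LinearMap.smulRight (toDual (diff n M f p)) (α p) := by
    ext v : 1
    rw [chartD_mulFun, toDual_diff]
    rfl
  rw [extD_apply_eq, h, AlternatingMap.alternatizeUncurryFin_add,
    AlternatingMap.alternatizeUncurryFin_smul, ← extD_apply_eq]
  rfl

theorem lieBr_apply_eq (X Y : VF n M) (p : M) :
    lieBr X Y p = chartDVec Y p (X p) - chartDVec X p (Y p) := by
  rw [← lieBr_center]
  exact congrArg₂ (· - ·)
    (congrArg (fderiv ℝ (hatField p Y) (extChartAt (𝓡 n) p p)) (hatField_center p X))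
    (congrArg (fderiv ℝ (hatField p X) (extChartAt (𝓡 n) p p)) (hatField_center p Y))

/-- `L_X α` in the chart at `p`, for a form of positive degree. -/
theorem lie_apply_eq (X : VF n M) (α : Form n M (k + 1)) (p : M) :
    (Form.contract X (extD n M (k + 1) α) + extD n M k (Form.contract X α)) p =
      chartD α p (X p) +
        AlternatingMap.alternatizeUncurryFin ((α p).curryLeft ∘ₗ chartDVec X p) := by
  have h : chartD (Form.contract X α) p =
      insertVec (X p) ∘ₗ chartD α p + (α p).curryLeft ∘ₗ chartDVec X p := by
    ext v : 1
    rw [chartD_contract]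
    rfl
  change insertVec (X p) (extD n M (k + 1) α p) + extD n M k (Form.contract X α) p = _
  rw [extD_apply_eq, extD_apply_eq, insertVec_alternatize_succ, h,
    AlternatingMap.alternatizeUncurryFin_add]
  abel

/-- `L_X f` in the chart at `p`, for a form of degree `0`. -/
theorem contract_extD_zero_apply (X : VF n M) (α : Form n M 0) (p : M) :
    Form.contract X (extD n M 0 α) p = chartD α p (X p) := by
  change insertVec (X p) (extD n M 0 α p) = _
  rw [extD_apply_eq, insertVec_alternatize_zero]

/-- Cartan's formula `ι_[X,Y] = L_X ι_Y - ι_Y L_X` in degree `1`. -/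
theorem contract_lieBr_one (X Y : VF n M) (α : Form n M 1) :
    Form.contract X (extD n M 0 (Form.contract Y α)) =
      Form.contract Y (Form.contract X (extD n M 1 α) + extD n M 0 (Form.contract X α)) +
        Form.contract (lieBr X Y) α := by
  refine Form.ext fun p => ?_
  rw [contract_extD_zero_apply, chartD_contract, Form.add_apply]
  change _ = insertVec (Y p) ((Form.contract X (extD n M 1 α) + extD n M 0 (Form.contract X α)) p) +
    (α p).curryLeft (lieBr X Y p)
  rw [lie_apply_eq, map_add, insertVec_alternatize_zero, lieBr_apply_eq, map_sub]
  change _ + (α p).curryLeft (chartDVec Y p (X p)) =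
    _ + (α p).curryLeft (chartDVec X p (Y p)) + _
  abel

/-- Cartan's formula `ι_[X,Y] = L_X ι_Y - ι_Y L_X` in degree at least `2`. -/
theorem contract_lieBr_succ (X Y : VF n M) (α : Form n M (k + 2)) :
    Form.contract X (extD n M (k + 1) (Form.contract Y α)) +
        extD n M k (Form.contract X (Form.contract Y α)) =
      Form.contract Y (Form.contract X (extD n M (k + 2) α) + extD n M (k + 1) (Form.contract X α)) +
        Form.contract (lieBr X Y) α := by
  refine Form.ext fun p => ?_
  rw [lie_apply_eq, chartD_contract, Form.add_apply]
  change _ = insertVec (Y p) ((Form.contract X (extD n M (k + 2) α) +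
    extD n M (k + 1) (Form.contract X α)) p) + (α p).curryLeft (lieBr X Y p)
  rw [lie_apply_eq, map_add, insertVec_alternatize_succ, lieBr_apply_eq, map_sub]
  have h : (Form.contract Y α p).curryLeft ∘ₗ chartDVec X p =
      (-1 : ℝ) • (insertVec (Y p) ∘ₗ (α p).curryLeft ∘ₗ chartDVec X p) := by
    ext v : 1
    rw [neg_one_smul]
    exact eq_neg_of_add_eq_zero_left (insertVec_anticomm _ _ _)
  rw [h, AlternatingMap.alternatizeUncurryFin_smul]
  change _ + (α p).curryLeft (chartDVec Y p (X p)) + _ =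
    _ + ((α p).curryLeft (chartDVec X p (Y p)) - _) + _
  module

end Chart

section Operators

variable {n : ℕ} {M : Type*} [TopologicalSpace M] [ChartedSpace (Model n) M]
  [IsManifold (𝓡 n) ∞ M] {k : ℕ}

/-! ### Pointwise evaluation of forms and operators -/

/-- The value at `p` of a differential form of mixed degree. -/
def evalAt (p : M) : Forms n M →ₗ[ℝ] FiberForms (Tan n p) :=
  DirectSum.toModule ℝ ℕ (FiberForms (Tan n p)) fun k => fiberIncl (Tan n p) k ∘ₗ
    ({ toFun := fun α => α p, map_add' := fun _ _ => rfl, map_smul' := fun _ _ => rfl } :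
      Form n M k →ₗ[ℝ] ((Tan n p) [⋀^Fin k]→ₗ[ℝ] ℝ))

theorem evalAt_incl (p : M) (α : Form n M k) :
    evalAt p (incl n M k α) = fiberIncl (Tan n p) k (α p) := by
  rw [evalAt, DirectSum.toModule_lof]; rfl

theorem op_ext {A B : Op n M} (h : ∀ k α, A (incl n M k α) = B (incl n M k α)) : A = B :=
  DirectSum.linearMap_ext ℝ fun k => LinearMap.ext (h k)

theorem forms_map_ext {W : Type*} [AddCommMonoid W] [Module ℝ W] {A B : Forms n M →ₗ[ℝ] W}
    (h : ∀ k α, A (incl n M k α) = B (incl n M k α)) : A = B :=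
  DirectSum.linearMap_ext ℝ fun k => LinearMap.ext (h k)

theorem evalAt_apply (p : M) (β : Forms n M) (j : ℕ) : evalAt p β j = β j p := by
  let L : Forms n M →ₗ[ℝ] ((Tan n p) [⋀^Fin j]→ₗ[ℝ] ℝ) :=
    { toFun := fun α => α j p, map_add' := fun _ _ => rfl, map_smul' := fun _ _ => rfl }
  have h : DirectSum.component ℝ ℕ (fun k => (Tan n p) [⋀^Fin k]→ₗ[ℝ] ℝ) j ∘ₗ evalAt p = L := by
    refine forms_map_ext fun k α => ?_
    rw [LinearMap.comp_apply, evalAt_incl]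
    change _ = (DirectSum.component ℝ ℕ (fun k => Form n M k) j (incl n M k α)) p
    by_cases hk : k = j
    · subst hk
      rw [DirectSum.component.lof_self, DirectSum.component.lof_self]
    · rw [DirectSum.component.of, DirectSum.component.of, dif_neg hk, dif_neg hk]
      rfl
  exact LinearMap.congr_fun h β

theorem forms_ext {β γ : Forms n M} (h : ∀ p : M, evalAt p β = evalAt p γ) : β = γ :=
  DirectSum.ext fun j => Form.ext fun p => by rw [← evalAt_apply, h, evalAt_apply]

theorem op_ext_evalAt {A B : Op n M}
    (h : ∀ (p : M) (k : ℕ) (α : Form n M k), evalAt p (A (incl n M k α)) =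
      evalAt p (B (incl n M k α))) : A = B :=
  op_ext fun k α => forms_ext fun p => h p k α

theorem opD_incl (α : Form n M k) [T2Space M] :
    opD n M (incl n M k α) = incl n M (k + 1) (extD n M k α) := by
  rw [opD, DirectSum.toModule_lof]; rfl

theorem opFun_incl (f : C^∞⟮𝓡 n, M; 𝓘(ℝ, ℝ), ℝ⟯) (α : Form n M k) :
    opFun f (incl n M k α) = incl n M k (Form.mulFun f α) := by
  rw [opFun, DirectSum.toModule_lof]; rfl

theorem opVec_incl_zero (X : VF n M) (α : Form n M 0) : opVec X (incl n M 0 α) = 0 := by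
  rw [opVec, DirectSum.toModule_lof]; rfl

theorem opVec_incl_succ (X : VF n M) (α : Form n M (k + 1)) :
    opVec X (incl n M (k + 1) α) = incl n M k (Form.contract X α) := by
  rw [opVec, DirectSum.toModule_lof]; rfl

theorem opOne_incl (ξ : Form n M 1) (α : Form n M k) :
    opOne ξ (incl n M k α) = incl n M (k + 1) (Form.wedge ξ α) := by
  rw [opOne, DirectSum.toModule_lof]; rfl

theorem evalAt_opFun (p : M) (f : C^∞⟮𝓡 n, M; 𝓘(ℝ, ℝ), ℝ⟯) (β : Forms n M) :
    evalAt p (opFun f β) = f p • evalAt p β := by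
  have h : evalAt p ∘ₗ opFun f = f p • evalAt p := forms_map_ext fun k α => by
    rw [LinearMap.comp_apply, LinearMap.smul_apply, opFun_incl, evalAt_incl, evalAt_incl,
      ← map_smul]
    rfl
  exact LinearMap.congr_fun h β

theorem evalAt_opVec (p : M) (X : VF n M) (β : Forms n M) :
    evalAt p (opVec X β) = fiberVec (X p) (evalAt p β) := by
  have h : evalAt p ∘ₗ opVec X = fiberVec (X p) ∘ₗ evalAt p :=
    forms_map_ext fun k α => by
      rw [LinearMap.comp_apply, LinearMap.comp_apply, evalAt_incl]
      match k, α with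
      | 0, α => rw [opVec_incl_zero, fiberVec_incl_zero, map_zero]
      | k + 1, α => rw [opVec_incl_succ, fiberVec_incl_succ, evalAt_incl]; rfl
  exact LinearMap.congr_fun h β

theorem evalAt_opOne (p : M) (ξ : Form n M 1) (β : Forms n M) :
    evalAt p (opOne ξ β) = fiberOne (ξ p) (evalAt p β) := by
  have h : evalAt p ∘ₗ opOne ξ = fiberOne (ξ p) ∘ₗ evalAt p :=
    forms_map_ext fun k α => by
      rw [LinearMap.comp_apply, LinearMap.comp_apply, evalAt_incl, opOne_incl, fiberOne_incl,
        evalAt_incl]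
      rfl
  exact LinearMap.congr_fun h β

theorem evalAt_op (p : M) (x : GSec n M) (β : Forms n M) :
    evalAt p (x.op β) = clifford (x.eval p) (evalAt p β) := by
  rw [GSec.op, LinearMap.add_apply, map_add, evalAt_opVec, evalAt_opOne]
  rfl

theorem op_ext_apply {A B : Op n M}
    (h : ∀ (p : M) (β : Forms n M), evalAt p (A β) = evalAt p (B β)) : A = B :=
  op_ext_evalAt fun p _ _ => h p _

/-- The contraction of a `1`-form with a vector field, as a smooth function. -/
def pairFun (ξ : Form n M 1) (X : VF n M) : C^∞⟮𝓡 n, M; 𝓘(ℝ, ℝ), ℝ⟯ :=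
  ⟨fun p => ξ p fun _ => X p, ξ.smooth' fun _ => X⟩

theorem pairFun_apply (ξ : Form n M 1) (X : VF n M) (p : M) :
    pairFun ξ X p = toDual (ξ p) (X p) := rfl

theorem opVec_opOne (X : VF n M) (ξ : Form n M 1) :
    opVec X * opOne ξ + opOne ξ * opVec X = opFun (pairFun ξ X) :=
  op_ext_apply fun p β => by
    have h := LinearMap.congr_fun (fiberVec_fiberOne (X p) (ξ p)) (evalAt p β)
    simp only [LinearMap.add_apply, Module.End.mul_apply, map_add, evalAt_opVec, evalAt_opOne,
      evalAt_opFun, pairFun_apply] at h ⊢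
    exact h

theorem opOne_anticomm (ξ η : Form n M 1) : opOne ξ * opOne η + opOne η * opOne ξ = 0 :=
  op_ext_apply fun p β => by
    have h := LinearMap.congr_fun (fiberOne_anticomm (ξ p) (η p)) (evalAt p β)
    simp only [LinearMap.add_apply, Module.End.mul_apply, map_add, evalAt_opOne,
      LinearMap.zero_apply, map_zero] at h ⊢
    exact h

theorem opFun_comm_opOne (f : C^∞⟮𝓡 n, M; 𝓘(ℝ, ℝ), ℝ⟯) (ξ : Form n M 1) :
    opFun f * opOne ξ = opOne ξ * opFun f :=
  op_ext_apply fun p β => by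
    simp only [Module.End.mul_apply, evalAt_opOne, evalAt_opFun, map_smul]

theorem opFun_comm_opVec (f : C^∞⟮𝓡 n, M; 𝓘(ℝ, ℝ), ℝ⟯) (X : VF n M) :
    opFun f * opVec X = opVec X * opFun f :=
  op_ext_apply fun p β => by
    simp only [Module.End.mul_apply, evalAt_opVec, evalAt_opFun, map_smul]

theorem opFun_add (f g : C^∞⟮𝓡 n, M; 𝓘(ℝ, ℝ), ℝ⟯) : opFun (f + g) = opFun f + opFun g :=
  op_ext_apply fun p β => by
    simp only [LinearMap.add_apply, map_add, evalAt_opFun]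
    exact add_smul _ _ _

theorem GSec.eval_add (x y : GSec n M) (p : M) : (x + y).eval p = x.eval p + y.eval p := rfl

theorem GSec.eval_smul (c : ℝ) (x : GSec n M) (p : M) : (c • x).eval p = c • x.eval p := rfl

theorem GSec.ext_eval {x y : GSec n M} (h : ∀ p, x.eval p = y.eval p) : x = y :=
  Prod.ext (ContMDiffSection.ext fun p => congrArg Prod.fst (h p))
    (Form.ext fun p => congrArg Prod.snd (h p))

variable (n M) in
/-- The representation of sections of the generalized tangent bundle by operators, as a linear
map. -/
def GSec.opL : GSec n M →ₗ[ℝ] Op n M where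
  toFun x := x.op
  map_add' x y := op_ext_apply fun p β => by
    rw [LinearMap.add_apply, map_add, evalAt_op, evalAt_op, evalAt_op, GSec.eval_add, map_add]
    rfl
  map_smul' c x := op_ext_apply fun p β => by
    rw [LinearMap.smul_apply, map_smul, evalAt_op, evalAt_op, GSec.eval_smul, map_smul]
    rfl

theorem GSec.opL_apply (x : GSec n M) : GSec.opL n M x = x.op := rfl

theorem opOne_add (ξ η : Form n M 1) : opOne (ξ + η) = opOne ξ + opOne η :=
  op_ext fun k α => by
    rw [LinearMap.add_apply, opOne_incl, opOne_incl, opOne_incl, ← map_add]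
    exact congrArg _ (Form.ext fun p => wedgeOne_add_left (ξ p) (η p) (α p))

theorem opOne_sub (ξ η : Form n M 1) : opOne (ξ - η) = opOne ξ - opOne η := by
  rw [eq_sub_iff_add_eq, ← opOne_add, sub_add_cancel]

/-! ### Cartan calculus for operators on forms -/

section Cartan

variable [T2Space M]

theorem exists_vectorField (p : M) (v : Tan n p) : ∃ X : VF n M, X p = v := by
  obtain ⟨W, hW⟩ := exists_coordField (n := n) p v
  refine ⟨W, hW.self_of_nhds.trans ?_⟩
  rw [mfderivWithin_range_extChartAt_symm]
  rfl

/-- A form of positive degree all of whose contractions vanish is zero. -/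
theorem Form.eq_zero_of_contract {β : Form n M (k + 1)} (h : ∀ Y, Form.contract Y β = 0) :
    β = 0 := by
  refine Form.ext fun p => ?_
  ext v
  obtain ⟨Y, hY⟩ := exists_vectorField p (v 0)
  have h1 : (β p).curryLeft (Y p) = 0 := congrArg (fun γ : Form n M k => γ p) (h Y)
  have h2 := DFunLike.congr_fun h1 (Fin.tail v)
  rw [hY] at h2
  rw [← Fin.cons_self_tail v]
  exact h2

/-- The operator `A` maps forms of degree `k` to forms of degree `k + m`. -/
def HasDegree (A : Op n M) (m : ℕ) : Prop :=
  ∀ (k : ℕ) (α : Form n M k), ∃ β, A (incl n M k α) = incl n M (k + m) β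

theorem HasDegree.mul {A B : Op n M} {a b : ℕ} (hA : HasDegree A a) (hB : HasDegree B b) :
    HasDegree (A * B) (b + a) := fun k α => by
  obtain ⟨β, hβ⟩ := hB k α
  rw [Module.End.mul_apply, hβ, ← Nat.add_assoc]
  exact hA _ β

theorem HasDegree.add {A B : Op n M} {a : ℕ} (hA : HasDegree A a) (hB : HasDegree B a) :
    HasDegree (A + B) a := fun k α => by
  obtain ⟨β, hβ⟩ := hA k α
  obtain ⟨γ, hγ⟩ := hB k α
  exact ⟨β + γ, by rw [LinearMap.add_apply, hβ, hγ, map_add]⟩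

theorem HasDegree.sub {A B : Op n M} {a : ℕ} (hA : HasDegree A a) (hB : HasDegree B a) :
    HasDegree (A - B) a := fun k α => by
  obtain ⟨β, hβ⟩ := hA k α
  obtain ⟨γ, hγ⟩ := hB k α
  exact ⟨β - γ, by rw [LinearMap.sub_apply, hβ, hγ, map_sub]⟩

theorem hasDegree_opD : HasDegree (opD n M) 1 := fun _ α => ⟨_, opD_incl α⟩

theorem hasDegree_opOne (ξ : Form n M 1) : HasDegree (opOne ξ) 1 := fun _ α => ⟨_, opOne_incl ξ α⟩

/-- An operator of positive degree which commutes up to a scalar with all contractions vanishes: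
by induction on `k`, all contractions of its values on `k`-forms are zero. -/
theorem eq_zero_of_comm_opVec {A : Op n M} {m : ℕ} (hA : HasDegree A (m + 1)) {t : ℝ}
    (h : ∀ Y, opVec Y * A = t • (A * opVec Y)) : A = 0 := by
  refine op_ext fun k => ?_
  induction k with
  | zero =>
    intro α
    obtain ⟨β, hβ⟩ := hA 0 α
    have hβ0 : (β : Form n M ((0 + m) + 1)) = 0 := Form.eq_zero_of_contract fun Y => by
      have h1 := LinearMap.congr_fun (h Y) (incl n M 0 α)
      rw [Module.End.mul_apply, LinearMap.smul_apply, Module.End.mul_apply, opVec_incl_zero,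
        map_zero, smul_zero, hβ] at h1
      exact DirectSum.of_injective (β := fun k => Form n M k) (0 + m)
        (((opVec_incl_succ (k := 0 + m) Y β).symm.trans h1).trans (map_zero _).symm)
    rw [hβ, LinearMap.zero_apply]
    exact (congrArg (incl n M (0 + m + 1)) hβ0).trans (map_zero _)
  | succ k ih =>
    intro α
    obtain ⟨β, hβ⟩ := hA (k + 1) α
    have hβ0 : (β : Form n M ((k + 1 + m) + 1)) = 0 := Form.eq_zero_of_contract fun Y => by
      have h1 := LinearMap.congr_fun (h Y) (incl n M (k + 1) α)
      rw [Module.End.mul_apply, LinearMap.smul_apply, Module.End.mul_apply, opVec_incl_succ,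
        ih, LinearMap.zero_apply, smul_zero, hβ] at h1
      exact DirectSum.of_injective (β := fun k => Form n M k) (k + 1 + m)
        (((opVec_incl_succ (k := k + 1 + m) Y β).symm.trans h1).trans (map_zero _).symm)
    rw [hβ, LinearMap.zero_apply]
    exact (congrArg (incl n M (k + 1 + m + 1)) hβ0).trans (map_zero _)

/-- The Lie derivative `L_X = [ι_X, d]` as an operator on forms. -/
def opLie (X : VF n M) : Op n M := opVec X * opD n M + opD n M * opVec X

theorem opLie_incl_zero (X : VF n M) (α : Form n M 0) :
    opLie X (incl n M 0 α) = incl n M 0 (Form.contract X (extD n M 0 α)) := by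
  rw [opLie, LinearMap.add_apply, Module.End.mul_apply, Module.End.mul_apply, opVec_incl_zero,
    map_zero, add_zero, opD_incl, opVec_incl_succ]

theorem opLie_incl_succ (X : VF n M) (α : Form n M (k + 1)) :
    opLie X (incl n M (k + 1) α) =
      incl n M (k + 1) (Form.contract X (extD n M (k + 1) α) + extD n M k (Form.contract X α)) := by
  rw [opLie, LinearMap.add_apply, Module.End.mul_apply, Module.End.mul_apply, opVec_incl_succ,
    opD_incl, opD_incl, opVec_incl_succ, map_add]

theorem hasDegree_opLie (X : VF n M) : HasDegree (opLie X) 0 := fun k α =>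
  match k, α with
  | 0, α => ⟨_, opLie_incl_zero X α⟩
  | _ + 1, α => ⟨_, opLie_incl_succ X α⟩

/-- Cartan's formula `[L_X, ι_Y] = ι_[X,Y]`. -/
theorem opLie_opVec (X Y : VF n M) :
    opLie X * opVec Y - opVec Y * opLie X = opVec (lieBr X Y) := by
  rw [sub_eq_iff_eq_add']
  refine op_ext fun k α => ?_
  rw [LinearMap.add_apply, Module.End.mul_apply, Module.End.mul_apply]
  match k, α with
  | 0, α =>
    rw [opVec_incl_zero, opVec_incl_zero, opLie_incl_zero, opVec_incl_zero, map_zero, add_zero]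
  | 1, α =>
    rw [opVec_incl_succ, opVec_incl_succ, opLie_incl_succ, opVec_incl_succ, opLie_incl_zero,
      ← map_add, contract_lieBr_one]
  | k + 2, α =>
    rw [opVec_incl_succ, opVec_incl_succ, opLie_incl_succ, opLie_incl_succ (k := k + 1) X α,
      opVec_incl_succ, ← map_add, contract_lieBr_succ]

theorem opD_opFun (f : C^∞⟮𝓡 n, M; 𝓘(ℝ, ℝ), ℝ⟯) :
    opD n M * opFun f - opFun f * opD n M = opOne (diff n M f) := by
  rw [sub_eq_iff_eq_add']
  refine op_ext fun k α => ?_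
  rw [LinearMap.add_apply, Module.End.mul_apply, Module.End.mul_apply, opFun_incl, opD_incl,
    opD_incl, opFun_incl, opOne_incl, ← map_add, extD_mulFun]

theorem opLie_opFun (X : VF n M) (f : C^∞⟮𝓡 n, M; 𝓘(ℝ, ℝ), ℝ⟯) :
    opLie X * opFun f - opFun f * opLie X = opFun (pairFun (diff n M f) X) := by
  rw [← opVec_opOne, ← opD_opFun, opLie]
  have h := opFun_comm_opVec f X
  linear_combination (norm := noncomm_ring) -(h * opD n M) - opD n M * h

theorem contract_eq_mulFun (Y : VF n M) (η : Form n M 1) :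
    Form.contract Y η = Form.mulFun (pairFun η Y) Form.one := by
  refine Form.ext fun p => ?_
  ext v
  change η p (Fin.cons (Y p) v) = η p (fun _ => Y p) * 1
  rw [mul_one]
  congr 1
  exact funext (Fin.cases rfl fun j => j.elim0)

theorem lieDeriv_eq (X : VF n M) (η : Form n M 1) :
    lieDeriv X η = Form.contract X (extD n M 1 η) + diff n M (pairFun η X) := by
  rw [lieDeriv, contract_eq_mulFun X η, diff]

theorem pairFun_diff (X : VF n M) (η : Form n M 1) (Y : VF n M) :
    pairFun (diff n M (pairFun η Y)) X = pairFun (lieDeriv X η) Y + pairFun η (lieBr X Y) := by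
  have h := contract_lieBr_one X Y η
  have h0 : ∀ (Z : VF n M) (ξ : Form n M 1) (p : M),
      Form.contract Z ξ p (Fin.elim0 : Fin 0 → Tan n p) = pairFun ξ Z p := fun Z ξ p => by
    rw [contract_eq_mulFun]; exact mul_one _
  ext p
  have h1 := congrArg (fun γ : Form n M 0 => γ p (Fin.elim0 : Fin 0 → Tan n p)) h
  change Form.contract X _ p _ = Form.contract Y (lieDeriv X η) p _ + Form.contract _ η p _ at h1
  rw [h0, h0, h0, contract_eq_mulFun Y η] at h1
  exact h1

/-- The formula `[L_X, η ∧] = (L_X η) ∧`. The difference of the two sides has degree `1` and commutes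
up to sign with contractions, by the Cartan formulas for `ι_Y`. -/
theorem opLie_opOne (X : VF n M) (η : Form n M 1) :
    opLie X * opOne η - opOne η * opLie X = opOne (lieDeriv X η) := by
  rw [← sub_eq_zero]
  have hdeg : HasDegree (opLie X * opOne η - opOne η * opLie X - opOne (lieDeriv X η)) (0 + 1) :=
    (((hasDegree_opLie X).mul (hasDegree_opOne η)).sub
      ((hasDegree_opOne η).mul (hasDegree_opLie X))).sub (hasDegree_opOne _)
  refine eq_zero_of_comm_opVec hdeg (t := -1) fun Y => ?_
  rw [neg_one_smul]
  have e1 := opLie_opVec X Y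
  have e2 := opVec_opOne Y η
  have e3 := opVec_opOne (lieBr X Y) η
  have e4 := opVec_opOne Y (lieDeriv X η)
  have e5 := opLie_opFun X (pairFun η Y)
  rw [pairFun_diff, opFun_add, ← e3, ← e4, ← e2, ← e1] at e5
  linear_combination (norm := noncomm_ring) e5

/-- The formula `[[ξ ∧, d], ι_Y] = -(ι_Y dξ) ∧`; the operator `[ξ ∧, d]` is multiplication by `dξ`. -/
theorem opOne_opD_opVec (ξ : Form n M 1) (Y : VF n M) :
    (opOne ξ * opD n M + opD n M * opOne ξ) * opVec Y -
      opVec Y * (opOne ξ * opD n M + opD n M * opOne ξ) =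
        -opOne (Form.contract Y (extD n M 1 ξ)) := by
  have e1 := opLie_opOne Y ξ
  have e2 := opVec_opOne Y ξ
  have e3 := opD_opFun (pairFun ξ Y)
  rw [lieDeriv_eq, opOne_add, ← e3, ← e2, opLie] at e1
  linear_combination (norm := noncomm_ring) -e1

/-- Multiplication by `dξ` commutes with multiplication by `η`. As for `opLie_opOne`, this is tested
by contractions. -/
theorem opOne_opD_opOne (ξ η : Form n M 1) :
    (opOne ξ * opD n M + opD n M * opOne ξ) * opOne η -
      opOne η * (opOne ξ * opD n M + opD n M * opOne ξ) = 0 := by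
  have hE : HasDegree (opOne ξ * opD n M + opD n M * opOne ξ) 2 :=
    ((hasDegree_opOne ξ).mul hasDegree_opD).add (hasDegree_opD.mul (hasDegree_opOne ξ))
  have hdeg : HasDegree ((opOne ξ * opD n M + opD n M * opOne ξ) * opOne η -
      opOne η * (opOne ξ * opD n M + opD n M * opOne ξ)) (2 + 1) :=
    (hE.mul (hasDegree_opOne η)).sub ((hasDegree_opOne η).mul hE)
  refine eq_zero_of_comm_opVec hdeg (t := -1) fun Y => ?_
  rw [neg_one_smul]
  have e1 := opOne_opD_opVec ξ Y
  have e2 := opVec_opOne Y η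
  have e3 := opD_opFun (pairFun η Y)
  have e4 := opOne_anticomm ξ (diff n M (pairFun η Y))
  have e5 := opFun_comm_opOne (pairFun η Y) ξ
  have e6 := opOne_anticomm η (Form.contract Y (extD n M 1 ξ))
  rw [← e3] at e4
  rw [← e2] at e4 e5
  linear_combination (norm := noncomm_ring) -(e1 * opOne η) - opOne η * e1 + e6 + e4 -
    opD n M * e5 - e5 * opD n M

/-- The Dorfman bracket is the derived bracket of the de Rham differential. -/
theorem derivedForm_opD (x y : GSec n M) :
    derivedForm (GSec.opL n M) (opD n M) x y = GSec.opL n M (dorfman x y) := by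
  have e1 := opLie_opVec x.1 y.1
  have e2 := opLie_opOne x.1 y.2
  have e3 := opOne_opD_opVec x.2 y.1
  have e4 := opOne_opD_opOne x.2 y.2
  rw [derivedForm_apply, GSec.opL_apply, GSec.opL_apply, GSec.opL_apply]
  change ((opVec x.1 + opOne x.2) * opD n M + opD n M * (opVec x.1 + opOne x.2)) *
    (opVec y.1 + opOne y.2) - (opVec y.1 + opOne y.2) *
    ((opVec x.1 + opOne x.2) * opD n M + opD n M * (opVec x.1 + opOne x.2)) =
    opVec (lieBr x.1 y.1) + opOne (lieDeriv x.1 y.2 - Form.contract y.1 (extD n M 1 x.2))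
  rw [opOne_sub, ← e1, ← e2, opLie]
  linear_combination (norm := noncomm_ring) e3 + e4

end Cartan

end Operators

/-! ### Skew-symmetric endomorphisms and their adjoints -/

section Adjoint

open Polynomial

variable {V : Type*} [AddCommGroup V] [Module ℝ V]

variable (V) in
/-- The pairing of `V ⊕ V*` as a bilinear form. -/
def dualPairingForm : (V × (V [⋀^Fin 1]→ₗ[ℝ] ℝ)) →ₗ[ℝ] (V × (V [⋀^Fin 1]→ₗ[ℝ] ℝ)) →ₗ[ℝ] ℝ :=
  LinearMap.mk₂ ℝ dualPairing
    (fun _ _ _ => by simp [dualPairing, toDual_add]; ring)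
    (fun _ _ _ => by simp [dualPairing, toDual_smul]; ring)
    (fun _ _ _ => by simp [dualPairing, toDual_add]; ring)
    (fun _ _ _ => by simp [dualPairing, toDual_smul]; ring)

theorem eq_zero_of_dualPairing {u : V × (V [⋀^Fin 1]→ₗ[ℝ] ℝ)} (h : ∀ v, dualPairing u v = 0) :
    u = 0 := by
  refine Prod.ext ?_ (alt_one_ext fun v => ?_)
  · refine (Module.forall_dual_apply_eq_zero_iff ℝ u.1).1 fun f => ?_
    have h1 := h (0, AlternatingMap.ofSubsingleton ℝ V ℝ (0 : Fin 1) f)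
    rw [dualPairing, map_zero, zero_add] at h1
    exact h1
  · have h1 := h (v, 0)
    simpa [dualPairing, toDual] using h1

/-- The adjoint of `P(ψ)` for a skew-symmetric `ψ` is `P(-ψ)`, so these vanish simultaneously. -/
theorem aeval_neg_eq_zero_of_skew {ψ : Module.End ℝ (V × (V [⋀^Fin 1]→ₗ[ℝ] ℝ))}
    (hψ : ∀ u v, dualPairing (ψ u) v = -dualPairing u (ψ v)) {P : ℝ[X]} (hP : aeval ψ P = 0) :
    aeval (-ψ) P = 0 := by
  let T : Module.End ℝ (V × (V [⋀^Fin 1]→ₗ[ℝ] ℝ)) →ₗ[ℝ]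
      ((V × (V [⋀^Fin 1]→ₗ[ℝ] ℝ)) →ₗ[ℝ] (V × (V [⋀^Fin 1]→ₗ[ℝ] ℝ)) →ₗ[ℝ] ℝ) :=
    ⟨⟨fun h => (dualPairingForm V).compl₂ h, fun _ _ => by ext <;> simp⟩,
      fun _ _ => by ext <;> simp⟩
  have h := aeval_apply_of_intertwine P T (f := ψ) (g := preLeft ℝ (-ψ)) fun k => by
    refine LinearMap.ext₂ fun u v => ?_
    change dualPairingForm V (-ψ u) ((ψ ^ k) v) = dualPairing u ((ψ ^ (k + 1)) v)
    rw [map_neg, LinearMap.neg_apply, pow_succ']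
    change -dualPairing (ψ u) _ = dualPairing u (ψ _)
    rw [hψ, neg_neg]
  rw [hP, map_zero] at h
  refine LinearMap.ext fun u => ?_
  refine eq_zero_of_dualPairing fun v => ?_
  have h1 := LinearMap.congr_fun₂ h u v
  rw [aeval_preLeft_apply] at h1
  exact h1

/-- The minimal polynomial of odd degree of a skew-symmetric endomorphism is an odd polynomial. -/
theorem coeff_minpoly_eq_zero_of_skew {ψ : Module.End ℝ (V × (V [⋀^Fin 1]→ₗ[ℝ] ℝ))}
    (hψ : ∀ u v, dualPairing (ψ u) v = -dualPairing u (ψ v))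
    (hodd : Odd (minpoly ℝ ψ).natDegree) {k : ℕ} (hk : Even k) : (minpoly ℝ ψ).coeff k = 0 := by
  set P := minpoly ℝ ψ with hP
  have hcoeff : ∀ i, (P + P.comp (-X)).coeff i = P.coeff i + (-1) ^ i * P.coeff i := fun i => by
    rw [coeff_add, show (-X : ℝ[X]) = C (-1) * X by simp, comp_C_mul_X_coeff, mul_comm (P.coeff i)]
  have hzero : P + P.comp (-X) = 0 := by
    refine eq_zero_of_dvd_of_degree_lt (p := P) ?_ ?_
    · refine minpoly.dvd ℝ ψ ?_
      have h0 : aeval ψ P = 0 := minpoly.aeval ℝ ψ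
      rw [map_add, h0, aeval_comp, map_neg, aeval_X, aeval_neg_eq_zero_of_skew hψ h0, add_zero]
    · have hP0 : P ≠ 0 := fun h => by simp [h] at hodd
      -- The leading terms of `P` and `P(-x)` cancel, so the sum has smaller degree than `P`.
      rw [degree_eq_natDegree hP0, degree_lt_iff_coeff_zero]
      intro m hm
      rw [hcoeff]
      rcases hm.eq_or_lt with rfl | hm
      · rw [hodd.neg_one_pow]; ring
      · rw [coeff_eq_zero_of_natDegree_lt hm]; ring
  have h := hcoeff k
  rw [hzero, hk.neg_one_pow, coeff_zero] at h
  linarith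

end Adjoint

variable {n : ℕ} {M : Type*} [TopologicalSpace M] [ChartedSpace (Model n) M]
  [IsManifold (𝓡 n) ∞ M] [T2Space M]

/-! ### Local frames and gluing of operators -/

section Frames

/-- The coordinate `1`-forms of the trivialization at `p`, cut off by a bump function. -/
theorem exists_coordForm (p : M) (i : Fin n) : ∃ E : Form n M 1, ∀ᶠ q in nhds p, ∀ v : Tan n q,
    toDual (E q) v =
      (trivializationAt (Model n) (TangentSpace (𝓡 n) : M → Type _) p).continuousLinearMapAt ℝ q v
        i := by
  set e := trivializationAt (Model n) (TangentSpace (𝓡 n) : M → Type _) p with he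
  have hbase : e.baseSet = (chartAt (Model n) p).source := by simp [e]
  obtain ⟨χ⟩ : Nonempty (SmoothBumpFunction (𝓡 n) p) := inferInstance
  refine ⟨⟨fun q => χ q • AlternatingMap.ofSubsingleton ℝ (Tan n q) ℝ (0 : Fin 1)
    ((EuclideanSpace.proj (𝕜 := ℝ) i).toLinearMap ∘ₗ (e.continuousLinearMapAt ℝ q).toLinearMap),
    fun X => ?_⟩, ?_⟩
  · have h := (e.contMDiffOn_section_baseSet_iff (IB := 𝓡 n) (n := ∞)).1
      ((X 0).contMDiff.contMDiffOn (s := e.baseSet))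
    rw [hbase] at h
    refine χ.contMDiff_smul (g := fun q => e.continuousLinearMapAt ℝ q (X 0 q) i) ?_
    have h2 := (EuclideanSpace.proj (𝕜 := ℝ) i : Model n →L[ℝ] ℝ).contMDiff.comp_contMDiffOn h
    refine h2.congr fun q hq => ?_
    rw [← hbase] at hq
    simp only [Function.comp]
    rw [Bundle.Trivialization.continuousLinearMapAt_apply,
      Bundle.Trivialization.coe_linearMapAt_of_mem _ hq]
    rfl
  · filter_upwards [χ.eventuallyEq_one] with q hq v
    change χ q * _ = _
    rw [hq]
    exact one_mul _

/-- Vector fields and `1`-forms which are dual frames near `p`: the coordinate fields and forms of the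
trivialization at `p`. -/
theorem exists_local_frame (p : M) : ∃ (W : Fin n → VF n M) (E : Fin n → Form n M 1),
    ∀ᶠ q in nhds p, IsDualFrame (fun i => W i q) (fun i => E i q) := by
  let b := EuclideanSpace.basisFun (Fin n) ℝ
  choose W hW using fun i : Fin n => exists_coordField (n := n) p (b i)
  choose E hE using fun i : Fin n => exists_coordForm p i
  refine ⟨W, E, ?_⟩
  filter_upwards [Filter.eventually_all.2 hW, Filter.eventually_all.2 hE,
    chart_source_mem_nhds (Model n) p] with q hq hq' hqs v
  set e := trivializationAt (Model n) (TangentSpace (𝓡 n) : M → Type _) p with he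
  have hbase : q ∈ e.baseSet := by simpa [e] using hqs
  have h1 : ∀ i, toDual (E i q) v • W i q =
      e.symmL ℝ q ((e.continuousLinearMapAt ℝ q v i) • b i) := fun i => by
    rw [map_smul, ← hq' i v, hq i]
    exact congrArg _ (DFunLike.congr_fun (TangentBundle.symmL_trivializationAt hqs) (b i)).symm
  rw [Finset.sum_congr rfl fun i _ => h1 i, ← map_sum]
  have h2 : ∑ i, (e.continuousLinearMapAt ℝ q v i) • b i = e.continuousLinearMapAt ℝ q v := by
    simpa [b] using b.sum_repr (e.continuousLinearMapAt ℝ q v)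
  rw [h2]
  exact e.symmL_continuousLinearMapAt hbase v

theorem alt_eq_zero_of_lt {p : M} {j : ℕ} (hj : n < j) (α : (Tan n p) [⋀^Fin j]→ₗ[ℝ] ℝ) :
    α = 0 := by
  ext v
  have : FiniteDimensional ℝ (Tan n p) := inferInstanceAs (FiniteDimensional ℝ (Model n))
  refine α.map_linearDependent v fun hv => ?_
  have h := hv.fintype_card_le_finrank
  have h' : Module.finrank ℝ (Tan n p) = n := finrank_euclideanSpace_fin (𝕜 := ℝ) (n := n)
  rw [h', Fintype.card_fin] at h
  omega

/-- A family of operators on the exterior algebras of the cotangent spaces which is locally given by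
operators on forms defines an operator on forms. -/
theorem exists_op_of_local (T : ∀ q : M, Module.End ℝ (FiberForms (Tan n q)))
    (hT : ∀ p : M, ∃ C : Op n M, ∀ᶠ q in nhds p, ∀ β, evalAt q (C β) = T q (evalAt q β)) :
    ∃ A : Op n M, ∀ (q : M) β, evalAt q (A β) = T q (evalAt q β) := by
  let comp (k j : ℕ) : Form n M k →ₗ[ℝ] Form n M j :=
    { toFun := fun α => ⟨fun q => T q (fiberIncl (Tan n q) k (α q)) j, fun V p => by
        obtain ⟨C, hC⟩ := hT p
        refine (((C (incl n M k α)) j).smooth' V p).congr_of_eventuallyEq ?_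
        filter_upwards [hC] with q hq
        rw [← evalAt_incl, ← hq, evalAt_apply]⟩
      map_add' := fun α β => Form.ext fun q => by
        change T q (fiberIncl (Tan n q) k (α q + β q)) j = _
        rw [map_add, map_add]
        rfl
      map_smul' := fun c α => Form.ext fun q => by
        change T q (fiberIncl (Tan n q) k (c • α q)) j = _
        rw [map_smul, map_smul]
        rfl }
  -- Forms of degree above `n` vanish, so the components of degree at most `n` suffice.
  let A : Op n M := DirectSum.toModule ℝ ℕ (Forms n M) fun k =>
    ∑ j ∈ Finset.range (n + 1), incl n M j ∘ₗ comp k j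
  refine ⟨A, fun q β => ?_⟩
  have h : evalAt q ∘ₗ A = T q ∘ₗ evalAt q := forms_map_ext fun k α => by
    rw [LinearMap.comp_apply, LinearMap.comp_apply, evalAt_incl]
    have hA : A (incl n M k α) = ∑ j ∈ Finset.range (n + 1), incl n M j (comp k j α) := by
      rw [DirectSum.toModule_lof, LinearMap.sum_apply]
      rfl
    rw [hA, map_sum]
    simp only [evalAt_incl]
    have hsum : ∀ x : FiberForms (Tan n q),
        ∑ j ∈ Finset.range (n + 1), fiberIncl (Tan n q) j (x j) = x := fun x => by
      refine DirectSum.ext fun i => ?_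
      rw [DirectSum.sum_apply]
      by_cases hi : i < n + 1
      · rw [Finset.sum_eq_single_of_mem i (Finset.mem_range.2 hi)]
        · exact DirectSum.of_eq_same _ _
        · intro j _ hj
          exact DirectSum.of_eq_of_ne _ _ _ hj.symm
      · rw [alt_eq_zero_of_lt (by omega) (x i)]
        exact alt_eq_zero_of_lt (by omega) _
    exact hsum _
  exact LinearMap.congr_fun h β

end Frames

/-! ### Existence of the lift -/

section Lift

variable (φ : BundleEndo n M)

/-- Skew-symmetry in terms of `dualPairing`, which is twice the inner product. -/
theorem BundleEndo.IsSkew.dualPairing_eq {φ : BundleEndo n M} (hφ : φ.IsSkew) (p : M)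
    (u v : GTan n p) : dualPairing (φ.fiber p u) v = -dualPairing u (φ.fiber p v) := by
  have h := hφ p u v
  change dualPairing (φ.fiber p u) v / 2 + dualPairing u (φ.fiber p v) / 2 = 0 at h
  linarith

/-- The spin lift of `φ` computed in a frame `W` and a coframe `E`. -/
def frameLift (W : Fin n → VF n M) (E : Fin n → Form n M 1) : Op n M :=
  (1 / 2 : ℝ) • ∑ i, (GSec.op (φ.apply (W i, 0)) * GSec.op (0, E i) +
    GSec.op (φ.apply (0, E i)) * GSec.op (W i, 0) - opFun (pairFun (E i) (φ.apply (W i, 0)).1))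

theorem evalAt_frameLift (W : Fin n → VF n M) (E : Fin n → Form n M 1) (q : M) (β : Forms n M) :
    evalAt q (frameLift φ W E β) =
      fiberLift (φ.fiber q) (fun i => W i q) (fun i => E i q) (evalAt q β) := by
  have h1 : ∀ i, (φ.apply (W i, 0)).eval q = φ.fiber q (W i q, 0) := fun i => φ.eval_apply _ q
  have h2 : ∀ i, (φ.apply (0, E i)).eval q = φ.fiber q (0, E i q) := fun i => φ.eval_apply _ q
  have h3 : ∀ i, pairFun (E i) (φ.apply (W i, 0)).1 q =
      toDual (E i q) (φ.fiber q (W i q, 0)).1 := fun i => by rw [← h1]; rfl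
  simp only [frameLift, fiberLift, LinearMap.smul_apply, LinearMap.sum_apply, map_smul, map_sum,
    liftTerm_apply, LinearMap.sub_apply, LinearMap.add_apply, map_sub, map_add,
    Module.End.mul_apply, evalAt_op, evalAt_opFun, h1, h2, h3, Module.End.one_apply]
  rfl

/-- A skew-symmetric endomorphism has a lift: the spin lift on the fibres is given near each point by
`frameLift` for a local frame, hence is smooth. -/
theorem exists_isLift {φ : BundleEndo n M} (hφ : φ.IsSkew) : ∃ A : Op n M, IsLift φ A := by
  choose W E hWE using fun p : M => exists_local_frame (n := n) p
  -- At `q` use the frame chosen for `q`; nearby the frame of another point gives the same lift.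
  let T : ∀ q : M, Module.End ℝ (FiberForms (Tan n q)) := fun q =>
    fiberLift (φ.fiber q) (fun i => W q i q) (fun i => E q i q)
  obtain ⟨A, hA⟩ := exists_op_of_local T fun p => ⟨frameLift φ (W p) (E p), by
    filter_upwards [hWE p] with q hq β
    rw [evalAt_frameLift, fiberLift_eq _ hq (hWE q).self_of_nhds]⟩
  refine ⟨A, fun k α j hjk => Form.ext fun p => ?_, fun f => ?_, fun x => ?_,
    (A (incl n M 0 Form.one)) 2, forms_ext fun p => ?_⟩
  · rw [← evalAt_apply, hA, evalAt_incl]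
    exact fiberLift_even _ _ _ hjk _
  · rw [gradedComm, mul_zero, pow_zero, one_smul, sub_eq_zero]
    exact op_ext_apply fun p β => by
      simp only [Module.End.mul_apply, hA, evalAt_opFun, map_smul]
  · rw [gradedComm, zero_mul, pow_zero, one_smul]
    refine op_ext_apply fun p β => ?_
    have h := LinearMap.congr_fun
      (fiberLift_comm _ (hφ.dualPairing_eq p) (hWE p).self_of_nhds (x.eval p)) (evalAt p β)
    rw [LinearMap.sub_apply, Module.End.mul_apply, Module.End.mul_apply] at h ⊢
    rw [map_sub, hA, evalAt_op, evalAt_op, hA, evalAt_op, φ.eval_apply]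
    exact h
  · rw [evalAt_incl, ← evalAt_apply, hA, evalAt_incl, fiberLift_const]
    exact congrArg (fiberIncl (Tan n p) 2) (DirectSum.of_eq_same
      (β := fun j : ℕ => (Tan n p) [⋀^Fin j]→ₗ[ℝ] ℝ) 2 _).symm

end Lift

/-! ### Minimality of generalized Nijenhuis operators -/

section Minimal

open Polynomial

/-- The action of a bundle endomorphism on sections, as a linear map. -/
def BundleEndo.applyL (φ : BundleEndo n M) : Module.End ℝ (GSec n M) where
  toFun x := φ.apply x
  map_add' x y := GSec.ext_eval fun p => by
    rw [φ.eval_apply, GSec.eval_add, GSec.eval_add, φ.eval_apply, φ.eval_apply, map_add]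
  map_smul' c x := GSec.ext_eval fun p => by
    rw [φ.eval_apply, GSec.eval_smul, RingHom.id_apply, GSec.eval_smul, φ.eval_apply, map_smul]

/-- Polynomials in `± φ` act fibrewise. -/
theorem BundleEndo.eval_aeval (φ : BundleEndo n M) (P : ℝ[X]) (t : ℝ) (x : GSec n M) (p : M) :
    (aeval (t • φ.applyL) P x).eval p = aeval (t • φ.fiber p) P (x.eval p) := by
  let T : Module.End ℝ (GSec n M) →ₗ[ℝ] GTan n p :=
    ⟨⟨fun h => (h x).eval p, fun _ _ => rfl⟩, fun _ _ => rfl⟩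
  exact (aeval_apply_of_intertwine P T (f := t • φ.applyL) (g := t • φ.fiber p) fun k => by
    rw [pow_succ']
    change t • φ.fiber p _ = (t • φ.apply _).eval p
    rw [GSec.eval_smul, φ.eval_apply]
    rfl).symm

variable {φ : BundleEndo n M} {P : ℝ[X]}

theorem IsGenPolyStructure.aeval_eq_zero (hφ : IsGenPolyStructure φ P) : aeval φ.applyL P = 0 :=
  LinearMap.ext fun x => GSec.ext_eval fun p => by
    have h := φ.eval_aeval P 1 x p
    rw [one_smul, one_smul] at h
    rw [h, ← hφ.2.2.2 p, minpoly.aeval]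
    rfl

theorem IsGenPolyStructure.aeval_neg_eq_zero (hφ : IsGenPolyStructure φ P) :
    aeval (-φ.applyL) P = 0 :=
  LinearMap.ext fun x => GSec.ext_eval fun p => by
    have h := φ.eval_aeval P (-1) x p
    have h0 : aeval (φ.fiber p) P = 0 := by rw [← hφ.2.2.2 p, minpoly.aeval]
    rw [neg_one_smul, neg_one_smul, aeval_neg_eq_zero_of_skew (hφ.1.dualPairing_eq p) h0] at h
    exact h

theorem IsLift.commutator {A : Op n M} (hA : IsLift φ A) (x : GSec n M) :
    A * GSec.opL n M x - GSec.opL n M x * A = GSec.opL n M (φ.applyL x) := by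
  have h := hA.2.2.1 x
  rw [gradedComm, zero_mul, pow_zero, one_smul] at h
  exact h

theorem derivedBracket_minimalOp (A : Op n M) (P : ℝ[X]) (x y : GSec n M) :
    derivedBracket (minimalOp A P) x.op y.op =
      derivedForm (GSec.opL n M) (aeval (commutator A) P (opD n M)) x y := by
  rw [derivedForm_apply, derivedBracket, gradedComm, gradedComm, zero_mul, one_mul, pow_zero,
    pow_one, one_smul, neg_one_smul, sub_neg_eq_add]
  rfl

end Minimal

end GenGeom

end

open GenGeom in
theorem mainTheorem12 (n : ℕ) (M : Type*) [TopologicalSpace M] [T2Space M]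
    [ChartedSpace (GenGeom.Model n) M] [IsManifold (𝓡 n) ∞ M]
    (φ : GenGeom.BundleEndo n M) (P : Polynomial ℝ) (hφ : GenGeom.IsGenPolyStructure φ P) :
    (GenGeom.IsGenNijenhuis φ → GenGeom.IsMinimal φ P) ∧
      (Odd P.natDegree → GenGeom.IsWeakGenNijenhuis φ → GenGeom.IsMinimal φ P) := by
  obtain ⟨A, hA⟩ := exists_isLift hφ.1
  refine ⟨fun hN => ⟨A, hA, fun x y => ?_⟩, fun hodd hN => ⟨A, hA, fun x y => ?_⟩⟩
  · rw [derivedBracket_minimalOp, derivedForm_eq_zero_of_nijenhuis P hA.commutator derivedForm_opD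
      hφ.aeval_neg_eq_zero hN]
    rfl
  -- Oddness of `P` is a statement about a fibre, so the empty manifold is treated separately.
  · rcases isEmpty_or_nonempty M with _ | ⟨⟨p⟩⟩
    · exact op_ext_apply fun p => isEmptyElim p
    have hP : ∀ k, Even k → P.coeff k = 0 := fun k hk => by
      have hp := hφ.2.2.2 p
      rw [← hp] at hodd ⊢
      exact coeff_minpoly_eq_zero_of_skew (hφ.1.dualPairing_eq p) hodd hk
    rw [derivedBracket_minimalOp, derivedForm_eq_zero_of_weakNijenhuis P hA.commutator
      derivedForm_opD hP hφ.aeval_eq_zero hφ.aeval_neg_eq_zero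
      (T := courantNijenhuis φ) (fun _ _ => rfl) hN]
    rfl
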